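/- **Setting.** Graphs are finite and simple. Let $\Sigma$ be a compact connected surface, possibly with boundary and not necessarily orientable; the components of its boundary are called cuffs. $\hat\Sigma$ is the closed surface obtained by filling every cuff with an open disk. Let $G$ be a graph embedded in $\Sigma$ so that each cuff either is (the drawing of) a cycle of $G$, called a *facial ring*, or meets $G$ in exactly one vertex, called a *vertex ring*. Let $\mathcal R$ be the set of all these rings; they are pairwise vertex-disjoint. A vertex is *internal* if it belongs to no ring. Faces of $G$ are the components of $\hat\Sigma-G$; a face is *internal* unless it is the disk filling the cuff of a facial ring. The *cuff face* of a vertex ring is the face containing the disk filling its cuff. The length $|f|$ of a face is the length of its boundary walk, and a $k$-face is a face of length $k$. A face is closed 2-cell if it is an open disk bounded by a cycle. Condition (I3) below makes the embedding in $\hat\Sigma$ cellular, so the embedding may be (and here is) given by a rotation system with edge signatures. **Conditions.** (I0) Every internal vertex has degree at least three. (I1) No even cycle of $G$ consists of internal vertices of degree three. (I3) Every internal face is closed 2-cell and has length at least $5$. (I4) If a path of length at most two has both ends in $\mathcal R$, it is a subgraph of the union of the rings. (I5) No two vertices of degree two in $G$ are adjacent. (I7) Any two distinct members of $\mathcal R$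 are at distance at least four. A subgraph $M\subseteq G$ *captures $(\le 4)$-cycles* if it contains all cycles of $G$ of length at most four and is either null or has minimum degree at least two. **Configurations.** The configurations $R_1,\dots,R_5$ consist of faces with pairwise distinct vertices, some of which are of prescribed degree three, and a set $\mathcal I$ of vertices. - $R_1$: a 5-face, all five vertices of prescribed degree three; $\mathcal I=\emptyset$. - $R_2$: a 7-face, all seven vertices of prescribed degree three; $\mathcal I=\emptyset$. - $R_3$: a 6-face $v_1v_2v_3v_4v_5v_6$, no prescribed degrees; $\mathcal I=\{v_1,v_3,v_5\}$. - $R_4$: 5-faces $v_1v_2v_3v_4v_5$ and $v_5v_4x_4yx_5$ sharing the edge $v_4v_5$; $v_1,v_3,v_4,v_5$ of prescribed degree three; $\mathcal I=\emptyset$. - $R_5$: 5-faces $v_3v_4v_5v_6v_7$ and $v_3v_2v_1v_8v_7$ sharing the edge $v_3v_7$; all of $v_1,\dots,v_8$ except $v_2,v_4$ of prescribed degree three; $\mathcal I=\{v_4,x_6\}$, where $x_6$ is the neighbor of $v_6$ other than $v_5,v_7$. A copy of such a configuration in $G$ *appears* if its faces are internal faces of $G$ that are not cuff faces of vertex rings;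 its vertices of prescribed degree three are internal and have degree three in $G$; at most one vertex of $\mathcal I$ belongs to $\mathcal R$, and no vertex of $\mathcal I$ is a vertex ring; and moreover - for $R_3$: some vertex of $\mathcal I$ belongs to $\mathcal R$, or there is a vertex of $\mathcal I$ that is internal together with all its neighbors; - for $R_4$: $v_2$ is internal of degree at least four, and neither $x_4$ nor $x_5$ is a vertex ring; - for $R_5$: $v_4$ is internal, and the face whose boundary contains the path $v_6v_7v_8$ has length at least seven. The copy *touches* $M$ if one of its faces is incident with an edge of $M$. **Dangerous faces.** A 5-face is *$k$-dangerous* if it is incident with no edge of $M$ and with exactly $k$ internal vertices of degree three. If $f_1=uvawb$ is 4-dangerous, where $w$ is the incident vertex that is not internal of degree three, then the other face incident with $uv$ is *linked to* $f_1$ *through* $uv$. If $y$ is a neighbor of $x$ and $\deg y=3$, then the face at $y$ between the two edges other than $xy$ is *opposite* to $x$. A 4-dangerous face is *extremely 4-dangerous* if it is neither incident with a vertex of $\mathcal R$ nor opposite to a vertex ring. **Primary charge.** The initial charge of an internal face $f$ is $|f|-4$, increased by $5/3$ if $f$ is incident with an edge of $M$. The primary charge arises by the following rules. 1. Every internal face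 sends $1/3$ to each incident vertex that has degree two and belongs to a facial ring, or is internal of degree three. 2. Every vertex of a facial ring sends $1/3$ to each incident 4-dangerous face. Every vertex ring sends $1/3$ to each incident face that is not a cuff face, $8/9$ to its cuff face and $1/3$ to each face opposite to it. 3. If $f$ is linked to an extremely 4-dangerous face $f'$ through an edge $uv$, and $|f|\ge 6$ or $f$ is incident with an edge of $M$ or $f$ is the cuff face of a vertex ring, then $f$ sends $1/3$ to $f'$ across $uv$. 4. If $v_1v_2v_3v_4$ is a subwalk of the boundary walk of an internal face $f'$ with $|f'|\ge 7$ that is linked to extremely 4-dangerous faces through both $v_1v_2$ and $v_3v_4$, and the other face $f$ incident with $v_2v_3$ has length at least six, then $f$ sends $1/9$ to $f'$ across $v_2v_3$. **Lemma.** Let $G$ be a graph in a surface $\Sigma$ with rings $\mathcal R$ satisfying (I0), (I1), (I3), (I4), (I5) and (I7), let $M$ be a subgraph of $G$ that captures $(\le 4)$-cycles, and assume that every copy of one of $R_1,\dots,R_5$ that appears in $G$ touches $M$. Let $f$ be an internal face of $G$. Then the primary charge of $f$ is non-negative. If it is zero, then $|f|=5$, $f$ is not incident with an edge of $M$, $f$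 is not a cuff face, and (a) $f$ is 3-dangerous, or (b) $f$ is incident with a vertex of $\mathcal R$, or (c) $f$ is 4-dangerous and a face of length at least $6$ is linked to $f$, or (d) $f$ is 4-dangerous, the face $h$ linked to $f$ has length five, and $h$ is incident with an edge of $M$ or is the cuff face of a vertex ring, or (e) $f$ is 4-dangerous and is opposite to a vertex ring. If the primary charge of $f$ is not zero, it is at least $2/9$. If $|f|\ge 8$, the primary charge of $f$ is at least $5|f|/9-4$. If $|f|=6$ and $f$ is incident with a vertex of degree two belonging to a facial ring, the primary charge of $f$ is at least $2/3$. -/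

import Mathlib

/-- A cellular (open 2-cell) embedding of a connected simple graph `G` in a closed surface,
orientable or not, given by its embedding scheme: a cyclic rotation of the darts (directed
edges) leaving each vertex, and a signature telling which edges are twisted (reverse the local
orientation).  Up to homeomorphism, cellular embeddings in closed connected surfaces and
embedding schemes are the same thing. -/
structure EmbeddingScheme {V : Type*} (G : SimpleGraph V) where
  connected : G.Connected
  rot : Equiv.Perm G.Dart
  rot_fst : ∀ d, (rot d).fst = d.fst
  rot_cyclic : ∀ d e : G.Dart, d.fst = e.fst → rot.SameCycle d e
  twisted : Sym2 V → Bool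

namespace EmbeddingScheme

variable {V : Type*} {G : SimpleGraph V} (E : EmbeddingScheme G)

/-- One step in the rotation at a vertex, forwards or backwards. -/
def turn (b : Bool) : Equiv.Perm G.Dart := if b then E.rot else E.rot⁻¹

/-- A flag `(d, b)` is a vertex `d.fst`, an edge `d` at it, and one of the two sides of `d`
(so also one of the two corners at `d.fst` next to `d`).  `alongEdge` moves to the other end of
the edge, staying on the same side of it. -/
def alongEdge (x : G.Dart × Bool) : G.Dart × Bool :=
  (x.1.symm, !(xor x.2 (E.twisted x.1.edge)))

/-- Move to the other edge of the corner in which the flag lies. -/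
def aroundCorner (x : G.Dart × Bool) : G.Dart × Bool := (E.turn (!x.2) x.1, !x.2)

/-- Move to the other side of the edge, keeping the vertex. -/
def acrossEdge (_E : EmbeddingScheme G) (x : G.Dart × Bool) : G.Dart × Bool := (x.1, !x.2)

/-- The face traversal: walk along the edge `x.1`, then turn to the next edge of the face. -/
def step (x : G.Dart × Bool) : G.Dart × Bool := E.aroundCorner (E.alongEdge x)

/-- Faces are the classes of flags under `alongEdge` and `aroundCorner`. -/
def Face : Type _ :=
  Quot fun x y : G.Dart × Bool => y = E.alongEdge x ∨ y = E.aroundCorner x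

/-- The face containing a flag. -/
def face (x : G.Dart × Bool) : E.Face := Quot.mk _ x

/-- The length of the boundary walk (an edge appearing twice counts twice): each side of an edge
carries exactly two flags, one at each end. -/
noncomputable def faceLength (f : E.Face) : ℕ := {x | E.face x = f}.ncard / 2

/-- The vertex `v` is incident with the face `f`. -/
def VertexInc (v : V) (f : E.Face) : Prop := ∃ x, E.face x = f ∧ x.1.fst = v

/-- The edge `e` is incident with the face `f`. -/
def EdgeInc (e : Sym2 V) (f : E.Face) : Prop := ∃ x, E.face x = f ∧ x.1.edge = e

/-- The boundary walk of `f` is a cycle: no vertex is visited twice, that is, `f` has a single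
corner (two flags) at each vertex it is incident with.  For the faces of a cellular embedding
this says that the face is closed 2-cell. -/
def BoundedByCycle (f : E.Face) : Prop :=
  3 ≤ E.faceLength f ∧ ∀ x y, E.face x = f → E.face y = f → x.1.fst = y.1.fst →
    y = x ∨ y = E.aroundCorner x

/-- The list `L` is the sequence of vertices of a boundary walk of `f` (any starting point and
either direction). -/
def Traces (f : E.Face) (L : List V) : Prop :=
  ∃ x, E.face x = f ∧ L = (List.range (E.faceLength f)).map fun i => ((E.step)^[i] x).1.fst

/-- `abc` is a subwalk of the boundary walk of `f`. -/
def HasSubwalk (f : E.Face) (a b c : V) : Prop :=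
  ∃ x, E.face x = f ∧ x.1.fst = a ∧ (E.step x).1.fst = b ∧ (E.step (E.step x)).1.fst = c

theorem EdgeInc.vertexInc {E : EmbeddingScheme G} {u v : V} {f : E.Face}
    (h : E.EdgeInc s(u, v) f) : E.VertexInc u f := by
  obtain ⟨x, hx, he⟩ := h
  rcases SimpleGraph.dart_edge_eq_mk'_iff.mp he with h | h
  · exact ⟨x, hx, by rw [h]⟩
  · refine ⟨E.alongEdge x, ?_, ?_⟩
    · rw [← hx]
      exact (show E.face x = E.face (E.alongEdge x) from Quot.sound (Or.inl rfl)).symm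
    · show x.1.snd = u
      rw [h]

/-- The rings of a graph in a surface with boundary.  The surface with boundary is the closed
surface of the scheme with one open disk removed for every ring.  A facial ring is the cycle
bounding a face that is such a disk; these faces are collected in `facial`.  A vertex ring is a
vertex that is the only intersection of the graph with the boundary of the removed disk; apart
from that vertex, the closed disk lies in one face, the cuff face of the vertex ring.  The removed
disks have disjoint closures, hence the rings are vertex-disjoint. -/
structure Rings where
  facial : Set E.Face
  vertexRing : Set V
  cuffFace : vertexRing → E.Face
  facial_cycle : ∀ f ∈ facial, E.BoundedByCycle f
  cuffFace_inc : ∀ v, E.VertexInc v.1 (cuffFace v)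
  cuffFace_notMem : ∀ v, cuffFace v ∉ facial
  facial_disjoint : ∀ f ∈ facial, ∀ g ∈ facial, f ≠ g → ∀ v, E.VertexInc v f → ¬ E.VertexInc v g
  vertex_disjoint : ∀ v ∈ vertexRing, ∀ f ∈ facial, ¬ E.VertexInc v f

namespace Rings

variable {E}
variable (R : E.Rings)

/-- A face is internal if it is not bounded by a facial ring as its removed disk. -/
def InternalFace (f : E.Face) : Prop := f ∉ R.facial

/-- The vertex belongs to a facial ring. -/
def OnFacial (v : V) : Prop := ∃ f ∈ R.facial, E.VertexInc v f

/-- The vertex belongs to some ring. -/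
def OnRing (v : V) : Prop := R.OnFacial v ∨ v ∈ R.vertexRing

/-- A vertex is internal if it belongs to no ring. -/
def Internal (v : V) : Prop := ¬ R.OnRing v

/-- `f` is the cuff face of the vertex ring `v`. -/
def IsCuffFaceOf (f : E.Face) (v : V) : Prop := ∃ h : v ∈ R.vertexRing, R.cuffFace ⟨v, h⟩ = f

/-- `f` is the cuff face of some vertex ring. -/
def IsCuffFace (f : E.Face) : Prop := ∃ v, R.IsCuffFaceOf f v

/-- The union of the rings, as a subgraph. -/
def subgraph : G.Subgraph where
  verts := {v | R.OnRing v}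
  Adj u v := G.Adj u v ∧ ∃ f ∈ R.facial, E.EdgeInc s(u, v) f
  adj_sub h := h.1
  edge_vert h := by
    obtain ⟨-, f, hf, he⟩ := h
    exact Or.inl ⟨f, hf, he.vertexInc⟩
  symm := ⟨fun u v h => ⟨h.1.symm, by
    obtain ⟨-, f, hf, he⟩ := h
    exact ⟨f, hf, by rwa [Sym2.eq_swap]⟩⟩⟩

/-- The members of the set of rings: facial rings, represented by their faces, and vertex rings. -/
def IsMember : E.Face ⊕ V → Prop
  | Sum.inl f => f ∈ R.facial
  | Sum.inr v => v ∈ R.vertexRing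

/-- The vertices of a ring. -/
def memberVerts (E : EmbeddingScheme G) : E.Face ⊕ V → Set V
  | Sum.inl f => {v | E.VertexInc v f}
  | Sum.inr v => {v}

/-- (I0) Every internal vertex has degree at least three. -/
def I0 [Fintype V] [DecidableRel G.Adj] : Prop := ∀ v, R.Internal v → 3 ≤ G.degree v

/-- An internal vertex of degree three. -/
def InternalCubic [Fintype V] [DecidableRel G.Adj] (v : V) : Prop :=
  R.Internal v ∧ G.degree v = 3

/-- (I1) No even cycle consists of internal vertices of degree three. -/
def I1 [Fintype V] [DecidableRel G.Adj] : Prop :=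
  ∀ (v : V) (c : G.Walk v v), c.IsCycle → Even c.length → ¬ ∀ u ∈ c.support, R.InternalCubic u

/-- (I3) Every internal face is closed 2-cell and has length at least five. -/
def I3 : Prop := ∀ f, R.InternalFace f → E.BoundedByCycle f ∧ 5 ≤ E.faceLength f

/-- (I4) A path of length at most two with both ends in the rings is a subgraph of their union. -/
def I4 : Prop := ∀ (u v : V) (p : G.Walk u v), p.IsPath → p.length ≤ 2 →
  R.OnRing u → R.OnRing v → p.toSubgraph ≤ R.subgraph

/-- (I5) No two vertices of degree two are adjacent. -/
def I5 (_R : E.Rings) [Fintype V] [DecidableRel G.Adj] : Prop :=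
  ∀ u v, G.Adj u v → ¬ (G.degree u = 2 ∧ G.degree v = 2)

/-- (I7) The distance between any two distinct rings is at least four. -/
def I7 : Prop := ∀ r s, R.IsMember r → R.IsMember s → r ≠ s →
  ∀ u ∈ memberVerts E r, ∀ v ∈ memberVerts E s, 4 ≤ G.dist u v

end Rings

/-- The face `f` is incident with an edge of the subgraph `M`. -/
def MeetsEdge (M : G.Subgraph) (f : E.Face) : Prop := ∃ e ∈ M.edgeSet, E.EdgeInc e f

/-- `M` contains all cycles of length at most four, and `M` is null or has minimum degree at
least two (the last condition is vacuous when `M` is null). -/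
def _root_.SimpleGraph.Subgraph.CapturesShortCycles {V : Type*} {G : SimpleGraph V}
    (M : G.Subgraph) : Prop :=
  (∀ (v : V) (c : G.Walk v v), c.IsCycle → c.length ≤ 4 → c.toSubgraph ≤ M) ∧
  ∀ v ∈ M.verts, 2 ≤ (M.neighborSet v).ncard

/-! ### Configurations -/

/-- A labelled copy in `G` of a configuration: its faces with their boundary walks, the list of
vertices incident with these faces, the vertices whose degree is prescribed to be three, and
the set `𝓘` of vertices to be identified. -/
structure ConfigCopy where
  faces : List (E.Face × List V)
  verts : List V
  cubic : List V
  ident : List V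

/-- `R1`: a 5-face all of whose vertices have degree three. -/
def copyR1 (f : E.Face) (v₁ v₂ v₃ v₄ v₅ : V) : E.ConfigCopy where
  faces := [(f, [v₁, v₂, v₃, v₄, v₅])]
  verts := [v₁, v₂, v₃, v₄, v₅]
  cubic := [v₁, v₂, v₃, v₄, v₅]
  ident := []

/-- `R2`: a 7-face all of whose vertices have degree three. -/
def copyR2 (f : E.Face) (v₁ v₂ v₃ v₄ v₅ v₆ v₇ : V) : E.ConfigCopy where
  faces := [(f, [v₁, v₂, v₃, v₄, v₅, v₆, v₇])]
  verts := [v₁, v₂, v₃, v₄, v₅, v₆, v₇]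
  cubic := [v₁, v₂, v₃, v₄, v₅, v₆, v₇]
  ident := []

/-- `R3`: a 6-face, with `𝓘` consisting of every other vertex. -/
def copyR3 (f : E.Face) (v₁ v₂ v₃ v₄ v₅ v₆ : V) : E.ConfigCopy where
  faces := [(f, [v₁, v₂, v₃, v₄, v₅, v₆])]
  verts := [v₁, v₂, v₃, v₄, v₅, v₆]
  cubic := []
  ident := [v₁, v₃, v₅]

/-- `R4`: two 5-faces `v₁v₂v₃v₄v₅` and `v₅v₄x₄yx₅` sharing the edge `v₄v₅`, where `v₁`, `v₃`,
`v₄`, `v₅` have degree three. -/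
def copyR4 (f h : E.Face) (v₁ v₂ v₃ v₄ v₅ x₄ y x₅ : V) : E.ConfigCopy where
  faces := [(f, [v₁, v₂, v₃, v₄, v₅]), (h, [v₅, v₄, x₄, y, x₅])]
  verts := [v₁, v₂, v₃, v₄, v₅, x₄, y, x₅]
  cubic := [v₁, v₃, v₄, v₅]
  ident := []

/-- `R5`: two 5-faces `v₃v₄v₅v₆v₇` and `v₃v₂v₁v₈v₇` sharing the edge `v₃v₇`, where all vertices
but `v₂` and `v₄` have degree three; `x₆` is the third neighbor of `v₆`, and `𝓘 = {v₄, x₆}`. -/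
def copyR5 (f h : E.Face) (v₁ v₂ v₃ v₄ v₅ v₆ v₇ v₈ x₆ : V) : E.ConfigCopy where
  faces := [(f, [v₃, v₄, v₅, v₆, v₇]), (h, [v₃, v₂, v₁, v₈, v₇])]
  verts := [v₁, v₂, v₃, v₄, v₅, v₆, v₇, v₈]
  cubic := [v₁, v₃, v₅, v₆, v₇, v₈]
  ident := [v₄, x₆]

/-- `M` touches the copy: it has an edge incident with one of the faces of the copy. -/
def ConfigCopy.Touches {E : EmbeddingScheme G} (c : E.ConfigCopy) (M : G.Subgraph) : Prop :=
  ∃ p ∈ c.faces, E.MeetsEdge M p.1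

namespace Rings

variable {E}
variable (R : E.Rings) [Fintype V] [DecidableRel G.Adj]

/-- Faint appearance: the vertices of the copy are distinct, its faces are internal faces of `G`
other than cuff faces of vertex rings and have the prescribed boundaries, the vertices of prescribed
degree three are internal and have degree three in `G`, and at most one vertex of `𝓘` is in a ring. -/
def FaintlyAppears (c : E.ConfigCopy) : Prop :=
  c.verts.Nodup ∧
  (∀ p ∈ c.faces, R.InternalFace p.1 ∧ ¬ R.IsCuffFace p.1 ∧ E.Traces p.1 p.2) ∧
  (∀ v ∈ c.cubic, R.InternalCubic v) ∧
  ∀ u ∈ c.ident, ∀ v ∈ c.ident, u ≠ v → R.Internal u ∨ R.Internal v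

/-- The conditions for appearance common to all configurations: faint appearance, and no vertex
ring belongs to `𝓘`. -/
def AppearsBase (c : E.ConfigCopy) : Prop :=
  R.FaintlyAppears c ∧ ∀ v ∈ c.ident, v ∉ R.vertexRing

/-- The labelled copies of the configurations `R1`, ..., `R5` that appear in `(G, R)`. -/
inductive Appears : E.ConfigCopy → Prop
  | r1 (f : E.Face) (v₁ v₂ v₃ v₄ v₅ : V) :
      R.AppearsBase (E.copyR1 f v₁ v₂ v₃ v₄ v₅) → Appears (E.copyR1 f v₁ v₂ v₃ v₄ v₅)
  | r2 (f : E.Face) (v₁ v₂ v₃ v₄ v₅ v₆ v₇ : V) :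
      R.AppearsBase (E.copyR2 f v₁ v₂ v₃ v₄ v₅ v₆ v₇) → Appears (E.copyR2 f v₁ v₂ v₃ v₄ v₅ v₆ v₇)
  | r3 (f : E.Face) (v₁ v₂ v₃ v₄ v₅ v₆ : V) :
      R.AppearsBase (E.copyR3 f v₁ v₂ v₃ v₄ v₅ v₆) →
      ((∃ v ∈ [v₁, v₃, v₅], R.OnRing v) ∨
        ∃ v ∈ [v₁, v₃, v₅], R.Internal v ∧ ∀ w, G.Adj v w → R.Internal w) →
      Appears (E.copyR3 f v₁ v₂ v₃ v₄ v₅ v₆)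
  | r4 (f h : E.Face) (v₁ v₂ v₃ v₄ v₅ x₄ y x₅ : V) :
      R.AppearsBase (E.copyR4 f h v₁ v₂ v₃ v₄ v₅ x₄ y x₅) →
      R.Internal v₂ → 4 ≤ G.degree v₂ → x₄ ∉ R.vertexRing → x₅ ∉ R.vertexRing →
      Appears (E.copyR4 f h v₁ v₂ v₃ v₄ v₅ x₄ y x₅)
  | r5 (f h g : E.Face) (v₁ v₂ v₃ v₄ v₅ v₆ v₇ v₈ x₆ : V) :
      R.AppearsBase (E.copyR5 f h v₁ v₂ v₃ v₄ v₅ v₆ v₇ v₈ x₆) →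
      G.Adj v₆ x₆ → x₆ ≠ v₅ → x₆ ≠ v₇ →
      R.Internal v₄ → E.HasSubwalk g v₆ v₇ v₈ → 7 ≤ E.faceLength g →
      Appears (E.copyR5 f h v₁ v₂ v₃ v₄ v₅ v₆ v₇ v₈ x₆)

/-! ### Charges -/

variable (M : G.Subgraph)

/-- `f` is a `k`-dangerous face. -/
def Dangerous (k : ℕ) (f : E.Face) : Prop :=
  E.faceLength f = 5 ∧ ¬ E.MeetsEdge M f ∧ {v | E.VertexInc v f ∧ R.InternalCubic v}.ncard = k

/-- The face `h` is linked to the 4-dangerous face `f` through the edge `e`: the edge `e` of `f` is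
the one opposite to the vertex of `f` that is not internal of degree three, and `h` is the face on
the other side of `e`. -/
def LinkedThrough (h f : E.Face) (e : Sym2 V) : Prop :=
  R.Dangerous M 4 f ∧ ∃ x, E.face x = f ∧ x.1.edge = e ∧
    ¬ R.InternalCubic ((E.step)^[3] x).1.fst ∧ E.face (E.acrossEdge x) = h

/-- `f` is opposite to the vertex `v`: some neighbor `y` of `v` has degree three, and `f` contains
the corner at `y` between the two edges other than `yv`. -/
def _root_.EmbeddingScheme.Opposite (E : EmbeddingScheme G) (f : E.Face) (v : V) : Prop :=
  ∃ x, E.face x = f ∧ G.degree x.1.fst = 3 ∧ G.Adj v x.1.fst ∧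
    x.1.snd ≠ v ∧ (E.aroundCorner x).1.snd ≠ v

/-- `f` is extremely 4-dangerous. -/
def Extreme (f : E.Face) : Prop :=
  R.Dangerous M 4 f ∧ (∀ v, E.VertexInc v f → ¬ R.OnRing v) ∧ ∀ v ∈ R.vertexRing, ¬ E.Opposite f v

/-- Rule 1: the internal face `f` sends 1/3 to the incident vertex `v`. -/
def Rule1 (f : E.Face) (v : V) : Prop :=
  R.InternalFace f ∧ E.VertexInc v f ∧ ((G.degree v = 2 ∧ R.OnFacial v) ∨ R.InternalCubic v)

/-- Rule 2, first part: the vertex `v` of a facial ring sends 1/3 to the 4-dangerous face `f`. -/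
def Rule2Facial (v : V) (f : E.Face) : Prop :=
  R.OnFacial v ∧ R.Dangerous M 4 f ∧ E.VertexInc v f

/-- Rule 2, second part: the vertex ring `v` sends 1/3 to the incident face `f`, not a cuff face. -/
def Rule2Inc (v : V) (f : E.Face) : Prop :=
  v ∈ R.vertexRing ∧ E.VertexInc v f ∧ ¬ R.IsCuffFace f

/-- Rule 2, last part: the vertex ring `v` sends 1/3 to the opposite face `f`. -/
def Rule2Opp (v : V) (f : E.Face) : Prop := v ∈ R.vertexRing ∧ E.Opposite f v

/-- Rule 3: `f` sends 1/3 to `f'` across the edge `e`. -/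
def Rule3 (f f' : E.Face) (e : Sym2 V) : Prop :=
  R.Extreme M f' ∧ R.LinkedThrough M f f' e ∧
    (6 ≤ E.faceLength f ∨ E.MeetsEdge M f ∨ R.IsCuffFace f)

/-- Rule 4: `f` sends 1/9 to `f'` across the edge `e`.  Here `x`, `step x`, `step (step x)` run
through the three consecutive edges `v₁v₂`, `v₂v₃`, `v₃v₄` of the boundary walk of `f'`. -/
def Rule4 (f f' : E.Face) (e : Sym2 V) : Prop :=
  R.InternalFace f' ∧ 7 ≤ E.faceLength f' ∧ 6 ≤ E.faceLength f ∧
  ∃ x, E.face x = f' ∧ (E.step x).1.edge = e ∧ E.face (E.acrossEdge (E.step x)) = f ∧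
    (∃ g, R.Extreme M g ∧ R.LinkedThrough M f' g x.1.edge) ∧
    ∃ g, R.Extreme M g ∧ R.LinkedThrough M f' g (E.step (E.step x)).1.edge

open Classical in
/-- The initial charge of a face. -/
noncomputable def initialCharge (f : E.Face) : ℝ :=
  (if R.InternalFace f then (E.faceLength f : ℝ) - 4 else 0) + if E.MeetsEdge M f then 5 / 3 else 0

/-- The primary charge of a face: the initial charge, minus everything the face sends and plus
everything it receives by Rules 1 to 4. -/
noncomputable def primaryCharge (f : E.Face) : ℝ :=
  R.initialCharge M f
  - 1 / 3 * {v | R.Rule1 f v}.ncard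
  + 1 / 3 * {v | R.Rule2Facial M v f}.ncard
  + 1 / 3 * {v | R.Rule2Inc v f}.ncard
  + 8 / 9 * {v | R.IsCuffFaceOf f v}.ncard
  + 1 / 3 * {v | R.Rule2Opp v f}.ncard
  - 1 / 3 * {p : E.Face × Sym2 V | R.Rule3 M f p.1 p.2}.ncard
  + 1 / 3 * {p : E.Face × Sym2 V | R.Rule3 M p.1 f p.2}.ncard
  - 1 / 9 * {p : E.Face × Sym2 V | R.Rule4 M f p.1 p.2}.ncard
  + 1 / 9 * {p : E.Face × Sym2 V | R.Rule4 M p.1 f p.2}.ncard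

end Rings

end EmbeddingScheme

/-!
The proof is a local discharging computation around one internal face `f`, carried out on flags.
With `alongEdge`, `aroundCorner` and `acrossEdge` as involutions on the flags, the boundary walk of
a face is an orbit of `step`, its length is the period of that orbit (`faceLength_face`), and at a
vertex of degree three the three involutions satisfy one more relation
(`aroundCorner_acrossEdge_cubic`), which identifies the faces and the vertices around an edge.

A face sends at most `1/3` to each of its vertices, and charge across an edge only in two positions:
`LinksExtreme`, where an extremely 4-dangerous face lies behind the edge (Rule 3), and
`BridgesExtreme`, the position of the sender in Rule 4. In both cases the ends of the edge are
internal of degree three, do not belong to `M`, and no vertex ring is near the edge along the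
boundary (`SpendsAcross`).

If `|f| ≥ 7`, then no two consecutive edges of `f` are in the first position because of the
configuration `R5` (`LinksExtreme.not_step`), and if two edges at distance two are, then `R5` also
forces a long face behind the edge between them, which returns `1/9` by Rule 4
(`LinksExtreme.six_le`). Splitting each `1/3` sent across an edge equally among this edge and its
two neighbors shows that an edge accounts for at most `1/9` on average, so that the charge is at
least `5|f|/9 - 4` (`le_primaryCharge_of_seven_le`). For `|f| = 7` this bound is negative, and a
further `1/3` is saved at a vertex that keeps its charge, which exists by `R2` and (I5).

If `|f| ≤ 6` and `f` meets an edge of `M` or is a cuff face, then no charge is sent across the edges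
near that edge of `M` or that vertex ring, and the extra `5/3` or `8/9` suffices. For any other
6-face, the configuration `R3` excludes that charge is sent across an edge, and, together with (I4)
and (I5), that the face meets a facial ring; a cycle of six internal vertices of degree three is
excluded by (I1). The remaining 5-faces send charge to vertices only. By `R1` they have at
most four internal vertices of degree three, and if they have four of them, then they receive charge
from an incident ring vertex, from an opposite vertex ring or, by `R4`, across the edge through which
a face is linked to them.
-/

/-! ### Flags and boundary walks -/

namespace EmbeddingScheme

section Flags

variable {V : Type*} {G : SimpleGraph V} (E : EmbeddingScheme G)

@[simp] theorem alongEdge_alongEdge (x : G.Dart × Bool) : E.alongEdge (E.alongEdge x) = x := by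
  obtain ⟨d, b⟩ := x
  simp [alongEdge]

@[simp] theorem aroundCorner_aroundCorner (x : G.Dart × Bool) :
    E.aroundCorner (E.aroundCorner x) = x := by
  obtain ⟨d, b⟩ := x
  cases b <;> simp [aroundCorner, turn]

@[simp] theorem acrossEdge_acrossEdge (x : G.Dart × Bool) :
    E.acrossEdge (E.acrossEdge x) = x := by
  simp [acrossEdge]

theorem acrossEdge_alongEdge (x : G.Dart × Bool) :
    E.acrossEdge (E.alongEdge x) = E.alongEdge (E.acrossEdge x) := by
  simp [acrossEdge, alongEdge]

theorem aroundCorner_ne (x : G.Dart × Bool) : E.aroundCorner x ≠ x := fun h => by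
  simpa [aroundCorner] using congrArg Prod.snd h

theorem acrossEdge_ne (x : G.Dart × Bool) : E.acrossEdge x ≠ x := fun h => by
  simpa [acrossEdge] using congrArg Prod.snd h

theorem alongEdge_ne (x : G.Dart × Bool) : E.alongEdge x ≠ x := fun h =>
  x.1.symm_ne (congrArg Prod.fst h)

@[simp] theorem turn_fst (b : Bool) (d : G.Dart) : (E.turn b d).fst = d.fst := by
  cases b
  · have := E.rot_fst (E.rot⁻¹ d)
    simpa [turn] using this.symm
  · exact E.rot_fst d

@[simp] theorem aroundCorner_fst (x : G.Dart × Bool) : (E.aroundCorner x).1.fst = x.1.fst :=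
  E.turn_fst _ _

@[simp] theorem acrossEdge_dart (x : G.Dart × Bool) : (E.acrossEdge x).1 = x.1 := rfl

@[simp] theorem alongEdge_fst (x : G.Dart × Bool) : (E.alongEdge x).1.fst = x.1.snd := rfl

@[simp] theorem alongEdge_snd (x : G.Dart × Bool) : (E.alongEdge x).1.snd = x.1.fst := rfl

@[simp] theorem alongEdge_edge (x : G.Dart × Bool) : (E.alongEdge x).1.edge = x.1.edge :=
  x.1.edge_symm

@[simp] theorem step_fst (x : G.Dart × Bool) : (E.step x).1.fst = x.1.snd := by simp [step]

theorem aroundCorner_step (x : G.Dart × Bool) : E.aroundCorner (E.step x) = E.alongEdge x := by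
  simp [step]

theorem alongEdge_step (x : G.Dart × Bool) :
    E.alongEdge (E.aroundCorner (E.step x)) = x := by
  simp [step]

@[simp] theorem step_alongEdge_aroundCorner (x : G.Dart × Bool) :
    E.step (E.alongEdge (E.aroundCorner x)) = x := by
  simp [step]

theorem step_alongEdge_step (x : G.Dart × Bool) :
    E.step (E.alongEdge (E.step x)) = E.alongEdge x := by
  simp [step]

theorem step_aroundCorner_step (x : G.Dart × Bool) :
    E.step (E.aroundCorner (E.step x)) = E.aroundCorner x := by
  simp [step]

theorem iterate_step_alongEdge (i : ℕ) (x : G.Dart × Bool) :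
    E.step^[i] (E.alongEdge (E.step^[i] x)) = E.alongEdge x := by
  induction i with
  | zero => rfl
  | succ i ih => rw [Function.iterate_succ_apply, Function.iterate_succ_apply',
      step_alongEdge_step, ih]

theorem iterate_step_aroundCorner (i : ℕ) (x : G.Dart × Bool) :
    E.step^[i] (E.aroundCorner (E.step^[i] x)) = E.aroundCorner x := by
  induction i with
  | zero => rfl
  | succ i ih => rw [Function.iterate_succ_apply, Function.iterate_succ_apply',
      step_aroundCorner_step, ih]

theorem step_injective : Function.Injective E.step :=
  Function.LeftInverse.injective (g := fun x => E.alongEdge (E.aroundCorner x))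
    fun x => E.alongEdge_step x

@[simp] theorem face_alongEdge (x : G.Dart × Bool) : E.face (E.alongEdge x) = E.face x :=
  (show E.face x = E.face (E.alongEdge x) from Quot.sound (Or.inl rfl)).symm

@[simp] theorem face_aroundCorner (x : G.Dart × Bool) : E.face (E.aroundCorner x) = E.face x :=
  (show E.face x = E.face (E.aroundCorner x) from Quot.sound (Or.inr rfl)).symm

@[simp] theorem face_step (x : G.Dart × Bool) : E.face (E.step x) = E.face x := by simp [step]

@[simp] theorem face_iterate_step (i : ℕ) (x : G.Dart × Bool) :
    E.face (E.step^[i] x) = E.face x := by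
  induction i with
  | zero => rfl
  | succ i ih => rw [Function.iterate_succ_apply', face_step, ih]

theorem exists_face_eq (f : E.Face) : ∃ x, E.face x = f := Quot.exists_rep f

theorem VertexInc.of_flag (x : G.Dart × Bool) : E.VertexInc x.1.fst (E.face x) := ⟨x, rfl, rfl⟩

/-- In the dihedral group generated by `alongEdge` and `aroundCorner`, the composition of
`aroundCorner` with a power of the rotation `step` is conjugate to one of these two fixed-point-free
involutions, so it fixes no flag. Hence the two directions of a boundary walk never mix. -/
theorem iterate_step_ne_aroundCorner (k : ℕ) (x : G.Dart × Bool) :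
    E.step^[k] x ≠ E.aroundCorner x := by
  induction k using Nat.strong_induction_on generalizing x with
  | _ k ih =>
    intro h
    match k, ih, h with
    | 0, _, h => exact E.aroundCorner_ne x h.symm
    | 1, _, h =>
      have h' := congrArg E.aroundCorner h
      simp only [Function.iterate_one, aroundCorner_step, aroundCorner_aroundCorner] at h'
      exact E.alongEdge_ne x h'
    | k + 2, ih, h =>
      refine ih k (by omega) (E.step x) (E.step_injective ?_)
      rw [step_aroundCorner_step, ← h, ← Function.iterate_succ_apply]
      exact (Function.iterate_succ_apply' E.step (k + 1) x).symm

theorem eq_or_eq_of_edge_eq {x y : G.Dart × Bool} (h : x.1.edge = y.1.edge) :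
    (x = y ∨ x = E.alongEdge y) ∨
      (x = E.acrossEdge y ∨ x = E.alongEdge (E.acrossEdge y)) := by
  obtain ⟨d, b⟩ := x
  obtain ⟨e, c⟩ := y
  rcases (SimpleGraph.dart_edge_eq_iff d e).mp h with rfl | rfl
  · cases b <;> cases c <;> simp [acrossEdge]
  · generalize ht : E.twisted e.edge = t
    cases b <;> cases c <;> cases t <;> simp [alongEdge, acrossEdge, ht]

end Flags

section FiniteFlags

variable {V : Type*} {G : SimpleGraph V} (E : EmbeddingScheme G) [Finite G.Dart]

instance : Finite E.Face := inferInstanceAs (Finite (Quot _))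

theorem minimalPeriod_step_pos (x : G.Dart × Bool) : 0 < Function.minimalPeriod E.step x :=
  Function.minimalPeriod_pos_of_mem_periodicPts (E.step_injective.mem_periodicPts x)

/-- The flags of a face are those of the boundary walk and their mates in the same corners. -/
theorem face_eq_iff {x y : G.Dart × Bool} : E.face y = E.face x ↔
    ∃ i < Function.minimalPeriod E.step x,
      y = E.step^[i] x ∨ y = E.aroundCorner (E.step^[i] x) := by
  constructor
  · intro h
    have key : ∀ y, (∃ i, y = E.step^[i] x ∨ y = E.aroundCorner (E.step^[i] x)) →
        (∃ i, E.alongEdge y = E.step^[i] x ∨ E.alongEdge y = E.aroundCorner (E.step^[i] x)) ∧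
        ∃ i, E.aroundCorner y = E.step^[i] x ∨
          E.aroundCorner y = E.aroundCorner (E.step^[i] x) := by
      rintro y ⟨i, rfl | rfl⟩
      · refine ⟨⟨i + 1, Or.inr ?_⟩, i, Or.inr rfl⟩
        rw [Function.iterate_succ_apply', aroundCorner_step]
      · refine ⟨?_, i, Or.inl (by simp)⟩
        obtain ⟨j, hj⟩ : ∃ j, E.step^[i] x = E.step^[j + 1] x := by
          refine ⟨i + (Function.minimalPeriod E.step x - 1), ?_⟩
          have := E.minimalPeriod_step_pos x
          rw [show i + (Function.minimalPeriod E.step x - 1) + 1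
            = i + Function.minimalPeriod E.step x by omega, Function.iterate_add_apply,
            Function.iterate_minimalPeriod]
        refine ⟨j, Or.inl ?_⟩
        rw [hj, Function.iterate_succ_apply', alongEdge_step]
    let p : G.Dart × Bool → Prop := fun y =>
      ∃ i, y = E.step^[i] x ∨ y = E.aroundCorner (E.step^[i] x)
    have hp : ∀ a b : G.Dart × Bool,
        (b = E.alongEdge a ∨ b = E.aroundCorner a) → p a = p b := by
      rintro a b (rfl | rfl)
      · refine propext ⟨fun h => (key a h).1, fun h => ?_⟩
        simpa [p] using (key _ h).1
      · refine propext ⟨fun h => (key a h).2, fun h => ?_⟩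
        simpa [p] using (key _ h).2
    have hy : p y := by
      -- `p` is constant on faces, and it holds at `x`
      have h' : Quot.lift p hp (E.face y) = Quot.lift p hp (E.face x) := by rw [h]
      change p y = p x at h'
      rw [h']
      exact ⟨0, Or.inl rfl⟩
    obtain ⟨i, hi⟩ := hy
    refine ⟨i % Function.minimalPeriod E.step x, Nat.mod_lt _ (E.minimalPeriod_step_pos x), ?_⟩
    rwa [Function.iterate_mod_minimalPeriod_eq]
  · rintro ⟨i, -, rfl | rfl⟩ <;> simp

/-- The length of a face is the period of its boundary walk: every step of the walk accounts for the
two flags of a corner. -/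
theorem faceLength_face (x : G.Dart × Bool) :
    E.faceLength (E.face x) = Function.minimalPeriod E.step x := by
  classical
  set n := Function.minimalPeriod E.step x with hn
  have hinj : Set.InjOn (fun i => E.step^[i] x) (Finset.range n : Set ℕ) := by
    intro i hi j hj h
    simp only [Finset.coe_range, Set.mem_Iio] at hi hj
    exact (Function.iterate_eq_iterate_iff_of_lt_minimalPeriod hi hj).mp h
  set A : Finset (G.Dart × Bool) := (Finset.range n).image fun i => E.step^[i] x with hA
  have hcA : A.card = n := by rw [hA, Finset.card_image_of_injOn hinj, Finset.card_range]
  have hcB : (A.image E.aroundCorner).card = n := by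
    rw [Finset.card_image_of_injective, hcA]
    exact Function.LeftInverse.injective E.aroundCorner_aroundCorner
  have hdisj : Disjoint A (A.image E.aroundCorner) := by
    rw [Finset.disjoint_left]
    intro y hy hy'
    simp only [hA, Finset.mem_image, Finset.mem_range, exists_exists_and_eq_and] at hy hy'
    obtain ⟨i, hi, rfl⟩ := hy
    obtain ⟨j, hj, hj'⟩ := hy'
    rcases le_total j i with h | h
    · refine E.iterate_step_ne_aroundCorner (i - j) (E.step^[j] x) ?_
      rw [← Function.iterate_add_apply, Nat.sub_add_cancel h, hj']
    · refine E.iterate_step_ne_aroundCorner (j - i) (E.step^[i] x) ?_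
      rw [← Function.iterate_add_apply, Nat.sub_add_cancel h, ← hj', aroundCorner_aroundCorner]
  have hset : {y | E.face y = E.face x} = ((A ∪ A.image E.aroundCorner : Finset _) : Set _) := by
    ext y
    simp only [Set.mem_ofPred_eq, face_eq_iff, Finset.coe_union, Set.mem_union, Finset.mem_coe,
      hA, Finset.mem_image, Finset.mem_range, exists_exists_and_eq_and]
    constructor
    · rintro ⟨i, hi, h | h⟩
      · exact Or.inl ⟨i, hi, h.symm⟩
      · exact Or.inr ⟨i, hi, h.symm⟩
    · rintro (⟨i, hi, h⟩ | ⟨i, hi, h⟩)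
      · exact ⟨i, hi, Or.inl h.symm⟩
      · exact ⟨i, hi, Or.inr h.symm⟩
  rw [faceLength, hset, Set.ncard_coe_finset, Finset.card_union_of_disjoint hdisj, hcA, hcB]
  omega

end FiniteFlags

end EmbeddingScheme

namespace EmbeddingScheme

/-! ### Faces bounded by cycles -/

section Cycles

variable {V : Type*} {G : SimpleGraph V} {E : EmbeddingScheme G}

theorem iterate_step_ne_aroundCorner_iterate (i j : ℕ) (x : G.Dart × Bool) :
    E.step^[i] x ≠ E.aroundCorner (E.step^[j] x) := by
  intro h
  rcases le_total j i with hij | hij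
  · refine E.iterate_step_ne_aroundCorner (i - j) (E.step^[j] x) ?_
    rw [← Function.iterate_add_apply, Nat.sub_add_cancel hij, h]
  · refine E.iterate_step_ne_aroundCorner (j - i) (E.step^[i] x) ?_
    rw [← Function.iterate_add_apply, Nat.sub_add_cancel hij, h, aroundCorner_aroundCorner]

variable [Finite G.Dart]

theorem iterate_faceLength (x : G.Dart × Bool) : E.step^[E.faceLength (E.face x)] x = x := by
  rw [faceLength_face, Function.iterate_minimalPeriod]

theorem faceLength_pos (x : G.Dart × Bool) : 0 < E.faceLength (E.face x) := by
  rw [faceLength_face]; exact E.minimalPeriod_step_pos x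

theorem iterate_step_mod (x : G.Dart × Bool) (i : ℕ) :
    E.step^[i % E.faceLength (E.face x)] x = E.step^[i] x := by
  rw [faceLength_face, Function.iterate_mod_minimalPeriod_eq]

/-- The flags of a face are those of the boundary walk and their mates at the other end of the
edge. -/
theorem face_eq_iff_alongEdge {x y : G.Dart × Bool} : E.face y = E.face x ↔
    ∃ i < E.faceLength (E.face x), y = E.step^[i] x ∨ y = E.alongEdge (E.step^[i] x) := by
  constructor
  · intro h
    obtain ⟨i, hi, rfl | rfl⟩ := E.face_eq_iff.mp h
    · exact ⟨i, by rwa [faceLength_face], Or.inl rfl⟩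
    · have hp := E.faceLength_pos x
      refine ⟨(i + (E.faceLength (E.face x) - 1)) % E.faceLength (E.face x), Nat.mod_lt _ hp,
        Or.inr ?_⟩
      rw [iterate_step_mod, ← aroundCorner_step, ← Function.iterate_succ_apply' E.step]
      rw [show (i + (E.faceLength (E.face x) - 1)).succ = i + E.faceLength (E.face x) by omega,
        Function.iterate_add_apply, iterate_faceLength]
  · rintro ⟨i, -, rfl | rfl⟩ <;> simp

theorem vertexInc_iff {v : V} {x : G.Dart × Bool} : E.VertexInc v (E.face x) ↔
    ∃ i < E.faceLength (E.face x), (E.step^[i] x).1.fst = v := by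
  constructor
  · rintro ⟨y, hy, rfl⟩
    rw [faceLength_face]
    obtain ⟨i, hi, rfl | rfl⟩ := E.face_eq_iff.mp hy
    · exact ⟨i, hi, rfl⟩
    · exact ⟨i, hi, by simp⟩
  · rintro ⟨i, -, rfl⟩
    exact ⟨_, by simp, rfl⟩

theorem edgeInc_iff {e : Sym2 V} {x : G.Dart × Bool} : E.EdgeInc e (E.face x) ↔
    ∃ i < E.faceLength (E.face x), (E.step^[i] x).1.edge = e := by
  constructor
  · rintro ⟨y, hy, rfl⟩
    obtain ⟨i, hi, rfl | rfl⟩ := face_eq_iff_alongEdge.mp hy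
    · exact ⟨i, hi, rfl⟩
    · exact ⟨i, hi, by simp⟩
  · rintro ⟨i, -, rfl⟩
    exact ⟨_, by simp, rfl⟩

namespace BoundedByCycle

variable {x : G.Dart × Bool} (hB : E.BoundedByCycle (E.face x))
include hB

theorem iterate_fst_injOn {i j : ℕ} (hi : i < E.faceLength (E.face x))
    (hj : j < E.faceLength (E.face x))
    (h : (E.step^[i] x).1.fst = (E.step^[j] x).1.fst) : i = j := by
  rw [faceLength_face] at hi hj
  rcases hB.2 (E.step^[i] x) (E.step^[j] x) (by simp) (by simp) h with h' | h'
  · exact ((Function.iterate_eq_iterate_iff_of_lt_minimalPeriod hj hi).mp h').symm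
  · exact absurd h' (iterate_step_ne_aroundCorner_iterate _ _ _)

/-- The two sides of an edge of a closed 2-cell face lie in different faces. -/
theorem face_acrossEdge_ne : E.face (E.acrossEdge x) ≠ E.face x := by
  intro h
  rcases hB.2 x (E.acrossEdge x) rfl h rfl with h' | h'
  · exact E.acrossEdge_ne x h'
  · -- the vertex of `x` has a single edge, so the walk would turn back and have length two
    have hd : (E.aroundCorner x).1 = x.1 := by rw [← h', acrossEdge_dart]
    rcases hB.2 (E.alongEdge (E.aroundCorner x)) (E.step x) (by simp) (by simp)
      (by simp [hd]) with h1 | h1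
    · have h2 : E.step^[2] x = x := by
        rw [Function.iterate_succ_apply, Function.iterate_one, h1, step_alongEdge_aroundCorner]
      have h3 := Function.IsPeriodicPt.minimalPeriod_le (n := 2) (by norm_num) h2
      have h4 := hB.1
      rw [faceLength_face] at h4
      omega
    · have h2 := E.alongEdge_step x
      rw [h1, aroundCorner_aroundCorner, alongEdge_alongEdge] at h2
      exact E.aroundCorner_ne x h2

theorem iterate_edge_injOn {i j : ℕ} (hi : i < E.faceLength (E.face x))
    (hj : j < E.faceLength (E.face x))
    (h : (E.step^[i] x).1.edge = (E.step^[j] x).1.edge) : i = j := by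
  have hB' : E.BoundedByCycle (E.face (E.step^[j] x)) := by simpa using hB
  rcases E.eq_or_eq_of_edge_eq h with (h' | h') | (h' | h')
  · exact hB.iterate_fst_injOn hi hj (by rw [h'])
  · rw [← aroundCorner_step, ← Function.iterate_succ_apply' E.step] at h'
    exact absurd h' (iterate_step_ne_aroundCorner_iterate _ _ _)
  · exact absurd (by rw [← h']; simp) hB'.face_acrossEdge_ne
  · exact absurd (by rw [← face_alongEdge, ← h']; simp) hB'.face_acrossEdge_ne

end BoundedByCycle

end Cycles

/-! ### Rotations and degrees -/

section Degrees

variable {V : Type*} {G : SimpleGraph V} (E : EmbeddingScheme G)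

theorem rot_pow_fst (k : ℕ) (d : G.Dart) : ((E.rot ^ k) d).fst = d.fst := by
  induction k with
  | zero => rfl
  | succ k ih => rw [pow_succ', Equiv.Perm.mul_apply, E.rot_fst, ih]

theorem snd_ne_of_ne {d e : G.Dart} (h : d.fst = e.fst) (hne : d ≠ e) : d.snd ≠ e.snd :=
  fun h' => hne (SimpleGraph.Dart.ext _ _ (Prod.ext h h'))

theorem exists_rot_pow_snd {n : ℕ} (hn : 0 < n) {d : G.Dart} (h : (E.rot ^ n) d = d) {w : V}
    (hw : G.Adj d.fst w) : ∃ k < n, ((E.rot ^ k) d).snd = w := by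
  obtain ⟨i, hi⟩ := E.rot_cyclic d ⟨(d.fst, w), hw⟩ rfl
  have hn' : (n : ℤ) ≠ 0 := by omega
  refine ⟨(i % n).toNat, ?_, ?_⟩
  · have := Int.emod_lt_of_pos i (show (0 : ℤ) < n by omega)
    omega
  · have h1 : (E.rot ^ (i % n).toNat) d = (E.rot ^ i) d := by
      rw [← zpow_natCast, Int.toNat_of_nonneg (Int.emod_nonneg _ hn')]
      conv_rhs => rw [← Int.emod_add_mul_ediv i n, zpow_add, zpow_mul, Equiv.Perm.mul_apply]
      congr 1
      refine (Equiv.Perm.zpow_apply_eq_self_of_apply_eq_self ?_ _).symm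
      rwa [zpow_natCast]
    rw [h1, hi]

variable [Fintype V] [DecidableRel G.Adj]

theorem degree_le_of_rot_pow_eq {n : ℕ} (hn : 0 < n) {d : G.Dart} (h : (E.rot ^ n) d = d) :
    G.degree d.fst ≤ n := by
  classical
  rw [← SimpleGraph.card_neighborFinset_eq_degree]
  calc _ ≤ ((Finset.range n).image fun k => ((E.rot ^ k) d).snd).card := by
        refine Finset.card_le_card fun w hw => ?_
        obtain ⟨k, hk, hk'⟩ := E.exists_rot_pow_snd hn h ((G.mem_neighborFinset _ _).mp hw)
        exact Finset.mem_image.mpr ⟨k, Finset.mem_range.mpr hk, hk'⟩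
    _ ≤ _ := Finset.card_image_le
    _ = n := Finset.card_range n

theorem degree_aroundCorner_fst (x : G.Dart × Bool) :
    G.degree (E.aroundCorner x).1.fst = G.degree x.1.fst :=
  congrArg (fun v => G.degree v) (E.aroundCorner_fst x)

/-- The rotation at a vertex is a single cycle, whose length is the degree. -/
theorem rot_pow_degree (d : G.Dart) : (E.rot ^ G.degree d.fst) d = d := by
  classical
  set n := G.degree d.fst with hn
  have hmaps : ∀ k ∈ Finset.range (n + 1), ((E.rot ^ k) d).snd ∈ G.neighborFinset d.fst := by
    intro k _
    rw [SimpleGraph.mem_neighborFinset, ← E.rot_pow_fst k d]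
    exact ((E.rot ^ k) d).adj
  obtain ⟨i, hi, j, hj, hij, he⟩ := Finset.exists_ne_map_eq_of_card_lt_of_maps_to
    (by rw [Finset.card_range, SimpleGraph.card_neighborFinset_eq_degree]; omega) hmaps
  have he' : (E.rot ^ i) d = (E.rot ^ j) d :=
    SimpleGraph.Dart.ext _ _ (Prod.ext ((E.rot_pow_fst i d).trans (E.rot_pow_fst j d).symm) he)
  clear he
  wlog hlt : i < j generalizing i j
  · exact this j hj i hi hij.symm he'.symm (by omega)
  have h1 : (E.rot ^ (j - i)) d = d := by
    apply (E.rot ^ i).injective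
    rw [← Equiv.Perm.mul_apply, ← pow_add, Nat.add_sub_cancel' hlt.le, he']
  have h2 := E.degree_le_of_rot_pow_eq (by omega) h1
  rw [Finset.mem_range] at hi hj
  rwa [show j - i = n by omega] at h1

theorem aroundCorner_dart_ne {x : G.Dart × Bool} (h : 2 ≤ G.degree x.1.fst) :
    (E.aroundCorner x).1 ≠ x.1 := by
  intro h'
  have h1 : E.rot x.1 = x.1 := by
    obtain ⟨d, b⟩ := x
    cases b
    · exact h'
    · exact (Equiv.Perm.inv_eq_iff_eq.mp h').symm
  have := E.degree_le_of_rot_pow_eq (n := 1) one_pos (by simpa using h1)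
  omega

theorem aroundCorner_acrossEdge_dart_ne {x : G.Dart × Bool} (h : 3 ≤ G.degree x.1.fst) :
    (E.aroundCorner (E.acrossEdge x)).1 ≠ (E.aroundCorner x).1 := by
  intro h'
  have h1 : E.rot (E.rot x.1) = x.1 := by
    obtain ⟨d, b⟩ := x
    cases b
    · exact (Equiv.Perm.inv_eq_iff_eq.mp h').symm
    · rw [show E.rot (d, true).1 = E.rot⁻¹ d from h']; simp
  have := E.degree_le_of_rot_pow_eq (n := 2) two_pos (by simpa [pow_two] using h1)
  omega

theorem aroundCorner_snd_ne {x : G.Dart × Bool} (h : 2 ≤ G.degree x.1.fst) :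
    (E.aroundCorner x).1.snd ≠ x.1.snd :=
  snd_ne_of_ne (E.aroundCorner_fst x) (E.aroundCorner_dart_ne h)

theorem aroundCorner_acrossEdge_snd_ne {x : G.Dart × Bool} (h : 3 ≤ G.degree x.1.fst) :
    (E.aroundCorner (E.acrossEdge x)).1.snd ≠ (E.aroundCorner x).1.snd :=
  snd_ne_of_ne (by simp) (E.aroundCorner_acrossEdge_dart_ne h)

theorem eq_of_adj_of_degree_eq_two {x : G.Dart × Bool} (h : G.degree x.1.fst = 2) {w : V}
    (hw : G.Adj x.1.fst w) : w = x.1.snd ∨ w = (E.aroundCorner x).1.snd := by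
  have h2 := E.rot_pow_degree x.1
  rw [h] at h2
  obtain ⟨k, hk, rfl⟩ := E.exists_rot_pow_snd two_pos h2 hw
  obtain ⟨d, b⟩ := x
  interval_cases k
  · exact Or.inl rfl
  · refine Or.inr ?_
    cases b
    · rfl
    · have : E.rot⁻¹ d = E.rot d := by
        rw [Equiv.Perm.inv_eq_iff_eq]; simpa [pow_two] using h2.symm
      simp [aroundCorner, turn, this]

theorem rot_inv_eq_of_degree_eq_three {d : G.Dart} (h : G.degree d.fst = 3) :
    E.rot⁻¹ d = E.rot (E.rot d) := by
  have h3 := E.rot_pow_degree d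
  rw [h] at h3
  rw [Equiv.Perm.inv_eq_iff_eq]
  simpa [pow_succ] using h3.symm

/-- The three neighbors of a vertex of degree three. -/
theorem eq_of_adj_of_degree_eq_three {x : G.Dart × Bool} (h : G.degree x.1.fst = 3) {w : V}
    (hw : G.Adj x.1.fst w) : w = x.1.snd ∨ w = (E.aroundCorner x).1.snd ∨
      w = (E.aroundCorner (E.acrossEdge x)).1.snd := by
  have h2 := E.rot_pow_degree x.1
  rw [h] at h2
  obtain ⟨k, hk, rfl⟩ := E.exists_rot_pow_snd three_pos h2 hw
  obtain ⟨d, b⟩ := x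
  have h3 := E.rot_inv_eq_of_degree_eq_three (d := d) h
  interval_cases k
  · exact Or.inl rfl
  · cases b <;> simp [aroundCorner, turn, acrossEdge]
  · cases b <;> simp [aroundCorner, turn, acrossEdge, h3, pow_two]

/-- Around a vertex of degree three there are three corners. -/
theorem aroundCorner_acrossEdge_cubic {x : G.Dart × Bool} (h : G.degree x.1.fst = 3) :
    E.acrossEdge (E.aroundCorner (E.acrossEdge x)) =
      E.aroundCorner (E.acrossEdge (E.aroundCorner x)) := by
  obtain ⟨d, b⟩ := x
  have h3 := E.rot_inv_eq_of_degree_eq_three (d := d) h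
  have h4 : E.rot⁻¹ (E.rot⁻¹ d) = E.rot d := by rw [h3]; simp
  cases b
  · simp only [aroundCorner, turn, acrossEdge]
    simpa using h3
  · simp only [aroundCorner, turn, acrossEdge]
    simpa using h4.symm

end Degrees

end EmbeddingScheme

/-! ### Vertices of boundary walks -/

namespace EmbeddingScheme

section Walks

variable {V : Type*} {G : SimpleGraph V} (E : EmbeddingScheme G)

/-- The `i`-th vertex of the boundary walk that starts in the flag `x`. -/
def walkVert (x : G.Dart × Bool) (i : ℕ) : V := (E.step^[i] x).1.fst

variable {E}

theorem walkVert_zero (x : G.Dart × Bool) : E.walkVert x 0 = x.1.fst := rfl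

theorem iterate_step_snd (x : G.Dart × Bool) (i : ℕ) :
    (E.step^[i] x).1.snd = E.walkVert x (i + 1) := by
  rw [walkVert, Function.iterate_succ_apply', step_fst]

theorem walkVert_one (x : G.Dart × Bool) : E.walkVert x 1 = x.1.snd :=
  (iterate_step_snd x 0).symm

theorem walkVert_iterate_step (x : G.Dart × Bool) (i j : ℕ) :
    E.walkVert (E.step^[j] x) i = E.walkVert x (i + j) := by
  rw [walkVert, walkVert, Function.iterate_add_apply]

theorem walkVert_step (x : G.Dart × Bool) (i : ℕ) :
    E.walkVert (E.step x) i = E.walkVert x (i + 1) := walkVert_iterate_step x i 1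

theorem walkVert_adj (x : G.Dart × Bool) (i : ℕ) :
    G.Adj (E.walkVert x i) (E.walkVert x (i + 1)) := by
  rw [← iterate_step_snd]
  exact (E.step^[i] x).1.adj

theorem iterate_step_edge (x : G.Dart × Bool) (i : ℕ) :
    (E.step^[i] x).1.edge = s(E.walkVert x i, E.walkVert x (i + 1)) := by
  rw [← iterate_step_snd]
  rfl

theorem vertexInc_walkVert (x : G.Dart × Bool) (i : ℕ) :
    E.VertexInc (E.walkVert x i) (E.face x) := ⟨E.step^[i] x, by simp, rfl⟩

theorem walkVert_two (x : G.Dart × Bool) :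
    E.walkVert x 2 = (E.aroundCorner (E.alongEdge x)).1.snd := by
  rw [← iterate_step_snd]
  rfl

theorem traces_walkVert (x : G.Dart × Bool) :
    E.Traces (E.face x) ((List.range (E.faceLength (E.face x))).map (E.walkVert x)) :=
  ⟨x, rfl, rfl⟩

theorem traces_five {x : G.Dart × Bool} (hL : E.faceLength (E.face x) = 5) :
    E.Traces (E.face x)
      [E.walkVert x 0, E.walkVert x 1, E.walkVert x 2, E.walkVert x 3, E.walkVert x 4] := by
  have := E.traces_walkVert x
  rwa [hL] at this

variable [Finite G.Dart]

theorem walkVert_add_faceLength (x : G.Dart × Bool) (i : ℕ) :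
    E.walkVert x (i + E.faceLength (E.face x)) = E.walkVert x i := by
  rw [walkVert, Function.iterate_add_apply, iterate_faceLength, walkVert]

theorem vertexInc_iff_walkVert {v : V} {x : G.Dart × Bool} : E.VertexInc v (E.face x) ↔
    ∃ i < E.faceLength (E.face x), E.walkVert x i = v := vertexInc_iff

theorem walkVert_alongEdge (x : G.Dart × Bool) {i j : ℕ}
    (h : i + j = E.faceLength (E.face x)) :
    E.walkVert (E.alongEdge x) i = E.walkVert x (j + 1) := by
  have h1 : E.step^[i] (E.step^[j] x) = x := by
    rw [← Function.iterate_add_apply, h, iterate_faceLength]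
  have h2 := E.iterate_step_alongEdge i (E.step^[j] x)
  rw [h1] at h2
  rw [walkVert, h2, alongEdge_fst, iterate_step_snd]

theorem iterate_step_pred (x : G.Dart × Bool) {j : ℕ}
    (h : j + 1 = E.faceLength (E.face x)) :
    E.step^[j] x = E.alongEdge (E.aroundCorner x) := by
  apply E.step_injective
  rw [step_alongEdge_aroundCorner, ← Function.iterate_succ_apply' E.step, Nat.succ_eq_add_one, h,
    iterate_faceLength]

theorem walkVert_pred (x : G.Dart × Bool) {j : ℕ}
    (h : j + 1 = E.faceLength (E.face x)) :
    E.walkVert x j = (E.aroundCorner x).1.snd := by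
  rw [walkVert, iterate_step_pred x h, alongEdge_fst]

theorem walkVert_aroundCorner (x : G.Dart × Bool) {i j : ℕ}
    (h : i + j = E.faceLength (E.face x)) :
    E.walkVert (E.aroundCorner x) i = E.walkVert x j := by
  have h1 : E.step^[i] (E.step^[j] x) = x := by
    rw [← Function.iterate_add_apply, h, iterate_faceLength]
  have h2 := E.iterate_step_aroundCorner i (E.step^[j] x)
  rw [h1] at h2
  rw [walkVert, h2, aroundCorner_fst, walkVert]

theorem BoundedByCycle.walkVert_injOn {x : G.Dart × Bool} (hB : E.BoundedByCycle (E.face x))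
    {i j : ℕ} (hi : i < E.faceLength (E.face x)) (hj : j < E.faceLength (E.face x))
    (h : E.walkVert x i = E.walkVert x j) : i = j :=
  hB.iterate_fst_injOn hi hj h

theorem BoundedByCycle.nodup {x : G.Dart × Bool} (hB : E.BoundedByCycle (E.face x)) :
    ((List.range (E.faceLength (E.face x))).map (E.walkVert x)).Nodup := by
  refine List.Nodup.map_on ?_ List.nodup_range
  intro i hi j hj h
  exact hB.walkVert_injOn (List.mem_range.mp hi) (List.mem_range.mp hj) h

theorem BoundedByCycle.nodup_five {x : G.Dart × Bool} (hB : E.BoundedByCycle (E.face x))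
    (hL : E.faceLength (E.face x) = 5) :
    [E.walkVert x 0, E.walkVert x 1, E.walkVert x 2, E.walkVert x 3, E.walkVert x 4].Nodup := by
  have := hB.nodup
  rwa [hL] at this

theorem walkVert_five {x : G.Dart × Bool} (hL : E.faceLength (E.face x) = 5) :
    E.walkVert x 5 = E.walkVert x 0 := by
  have := walkVert_add_faceLength x 0 (E := E)
  rwa [hL] at this

theorem Traces.rotate_five {f : E.Face} {a b c d e : V} (h : E.Traces f [a, b, c, d, e]) :
    E.Traces f [b, c, d, e, a] := by
  obtain ⟨x, rfl, hx⟩ := h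
  have hL : E.faceLength (E.face x) = 5 := by simpa using (congrArg List.length hx).symm
  have h5 := traces_five (E := E) (x := E.step x) (by rwa [face_step])
  simp only [walkVert_step, face_step, Nat.reduceAdd, walkVert_five hL] at h5
  rw [hL] at hx
  simp only [show (List.range 5) = [0, 1, 2, 3, 4] from rfl, List.map_cons, List.map_nil,
    List.cons.injEq, and_true] at hx
  obtain ⟨rfl, rfl, rfl, rfl, rfl⟩ := hx
  exact h5

theorem Traces.reflect_five {f : E.Face} {a b c d e : V} (h : E.Traces f [a, b, c, d, e]) :
    E.Traces f [b, a, e, d, c] := by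
  obtain ⟨x, rfl, hx⟩ := h
  have hL : E.faceLength (E.face x) = 5 := by simpa using (congrArg List.length hx).symm
  have h5 := traces_five (E := E) (x := E.alongEdge x) (by rwa [face_alongEdge])
  have h1 : E.walkVert (E.alongEdge x) 1 = E.walkVert x 0 :=
    (walkVert_alongEdge x (j := 4) (by rw [hL])).trans (walkVert_five hL)
  rw [walkVert_zero, h1, walkVert_alongEdge x (i := 2) (j := 3) (by rw [hL]),
    walkVert_alongEdge x (i := 3) (j := 2) (by rw [hL]),
    walkVert_alongEdge x (i := 4) (j := 1) (by rw [hL]), face_alongEdge, alongEdge_fst,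
    ← walkVert_one] at h5
  rw [hL] at hx
  simp only [show (List.range 5) = [0, 1, 2, 3, 4] from rfl, List.map_cons, List.map_nil,
    List.cons.injEq, and_true] at hx
  obtain ⟨rfl, rfl, rfl, rfl, rfl⟩ := hx
  exact h5

end Walks

/-! ### Short cycles and adjacent 5-faces -/

section Capture

variable {V : Type*} {G : SimpleGraph V} {M : G.Subgraph}

theorem _root_.SimpleGraph.Subgraph.CapturesShortCycles.adj_of_triangle
    (hM : M.CapturesShortCycles) {p q r : V} (hpq : G.Adj p q) (hqr : G.Adj q r)
    (hrp : G.Adj r p) : M.Adj p q := by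
  let c : G.Walk p p := .cons hpq (.cons hqr (.cons hrp .nil))
  have hc : c.IsCycle := by
    rw [SimpleGraph.Walk.cons_isCycle_iff]
    have := hpq.ne; have := hqr.ne; have := hrp.ne
    simp [SimpleGraph.Walk.cons_isPath_iff]
    grind
  have h := hM.1 p c hc (by simp [c])
  exact h.2 (by simp [c])

theorem _root_.SimpleGraph.Subgraph.CapturesShortCycles.adj_of_quadrangle
    (hM : M.CapturesShortCycles) {p q r s : V} (hpq : G.Adj p q) (hqr : G.Adj q r)
    (hrs : G.Adj r s) (hsp : G.Adj s p) (hpr : p ≠ r) (hqs : q ≠ s) : M.Adj p q := by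
  let c : G.Walk p p := .cons hpq (.cons hqr (.cons hrs (.cons hsp .nil)))
  have hc : c.IsCycle := by
    rw [SimpleGraph.Walk.cons_isCycle_iff]
    have := hpq.ne; have := hqr.ne; have := hrs.ne; have := hsp.ne
    simp [SimpleGraph.Walk.cons_isPath_iff]
    grind
  have h := hM.1 p c hc (by simp [c])
  exact h.2 (by simp [c])

variable {E : EmbeddingScheme G}

theorem not_adj_of_not_meetsEdge {x : G.Dart × Bool} (h : ¬ E.MeetsEdge M (E.face x)) :
    ¬ M.Adj x.1.fst x.1.snd :=
  fun h' => h ⟨_, h', x, rfl, rfl⟩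

theorem not_adj_walkVert {x : G.Dart × Bool} (h : ¬ E.MeetsEdge M (E.face x)) (i : ℕ) :
    ¬ M.Adj (E.walkVert x i) (E.walkVert x (i + 1)) := by
  rw [← iterate_step_snd]
  exact not_adj_of_not_meetsEdge (E := E) (x := E.step^[i] x) (by simpa using h)

/-- Two 5-faces that share an edge with both ends of degree at least three, and meet no edge of a
subgraph that captures the short cycles, have no further vertex in common. -/
theorem two_pentagons_nodup [Fintype V] [DecidableRel G.Adj] (hM : M.CapturesShortCycles)
    {x : G.Dart × Bool}
    (hg : E.BoundedByCycle (E.face x)) (hgL : E.faceLength (E.face x) = 5)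
    (hgM : ¬ E.MeetsEdge M (E.face x))
    (hh : E.BoundedByCycle (E.face (E.acrossEdge x)))
    (hhL : E.faceLength (E.face (E.acrossEdge x)) = 5)
    (hhM : ¬ E.MeetsEdge M (E.face (E.acrossEdge x)))
    (h0 : 3 ≤ G.degree x.1.fst) (h1 : 3 ≤ G.degree x.1.snd) :
    [E.walkVert x 0, E.walkVert x 1, E.walkVert x 2, E.walkVert x 3, E.walkVert x 4,
      E.walkVert (E.acrossEdge x) 2, E.walkVert (E.acrossEdge x) 3,
      E.walkVert (E.acrossEdge x) 4].Nodup := by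
  have ng := hg.nodup_five hgL
  have nh := hh.nodup_five hhL
  have e2 : E.walkVert (E.acrossEdge x) 2 ≠ E.walkVert x 2 := by
    rw [walkVert_two, walkVert_two, ← acrossEdge_alongEdge]
    exact E.aroundCorner_acrossEdge_snd_ne (x := E.alongEdge x) h1
  have e4 : E.walkVert (E.acrossEdge x) 4 ≠ E.walkVert x 4 := by
    rw [walkVert_pred _ (by rw [hhL]), walkVert_pred _ (by rw [hgL])]
    exact E.aroundCorner_acrossEdge_snd_ne h0
  have z0 : E.walkVert (E.acrossEdge x) 0 = E.walkVert x 0 := rfl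
  have z1 : E.walkVert (E.acrossEdge x) 1 = E.walkVert x 1 := by simp [walkVert_one]
  have ag := fun i => walkVert_adj (E := E) x i
  have ah := fun i => walkVert_adj (E := E) (E.acrossEdge x) i
  have mg := fun i => not_adj_walkVert hgM i
  have mh := fun i => not_adj_walkVert hhM i
  have ag4 := ag 4
  have ah4 := ah 4
  have mg4 := mg 4
  simp only [walkVert_five hgL, walkVert_five hhL, Nat.reduceAdd] at ag4 ah4 mg4
  have ag0 := ag 0; have ag1 := ag 1; have ag2 := ag 2; have ag3 := ag 3
  have ah1 := ah 1; have ah2 := ah 2; have ah3 := ah 3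
  have mg0 := mg 0; have mg1 := mg 1; have mg2 := mg 2; have mg3 := mg 3
  simp only [Nat.reduceAdd, zero_add] at *
  clear ag ah mg mh
  rw [z0, z1] at nh
  rw [z0] at ah4
  rw [z1] at ah1
  generalize E.walkVert (E.acrossEdge x) 2 = t2 at *
  generalize E.walkVert (E.acrossEdge x) 3 = t3 at *
  generalize E.walkVert (E.acrossEdge x) 4 = t4 at *
  generalize E.walkVert x 0 = q0 at *
  generalize E.walkVert x 1 = q1 at *
  generalize E.walkVert x 2 = q2 at *
  generalize E.walkVert x 3 = q3 at *
  generalize E.walkVert x 4 = q4 at *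
  clear z0 z1
  have t23 : t2 ≠ q3 := by
    rintro rfl; exact mg1 (hM.adj_of_triangle ag1 ag2 ah1.symm)
  have t24 : t2 ≠ q4 := by
    rintro rfl; exact mg0 (hM.adj_of_triangle ag0 ah1 ag4)
  have t43 : t4 ≠ q3 := by
    rintro rfl; exact mg4 (hM.adj_of_triangle ag4 ah4.symm ag3)
  have t42 : t4 ≠ q2 := by
    rintro rfl; exact mg0 (hM.adj_of_triangle ag0 ag1 ah4)
  have t32 : t3 ≠ q2 := by
    rintro rfl; exact mg1 (hM.adj_of_triangle ag1 ah2.symm ah1.symm)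
  have t34 : t3 ≠ q4 := by
    rintro rfl; exact mg4 (hM.adj_of_triangle ag4 ah4.symm ah3.symm)
  have t33 : t3 ≠ q3 := by
    rintro rfl
    exact mg1 (hM.adj_of_quadrangle ag1 ag2 ah2.symm ah1.symm (by simp at ng; tauto) e2.symm)
  simp only [List.nodup_cons, List.mem_cons, List.not_mem_nil, or_false, not_or,
    not_false_eq_true, and_true, List.nodup_nil] at ng nh ⊢
  grind

end Capture

end EmbeddingScheme

/-! ### Extremely 4-dangerous faces and the charge sent across edges -/

namespace EmbeddingScheme

namespace Rings

section Local

variable {V : Type*} {G : SimpleGraph V} {E : EmbeddingScheme G} {R : E.Rings}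

theorem Internal.internalFace {v : V} {f : E.Face} (hv : R.Internal v) (h : E.VertexInc v f) :
    R.InternalFace f := fun hf => hv (Or.inl ⟨f, hf, h⟩)

theorem Internal.not_mem_vertexRing {v : V} (hv : R.Internal v) : v ∉ R.vertexRing :=
  fun h => hv (Or.inr h)

theorem not_isCuffFace {f : E.Face} (h : ∀ v, E.VertexInc v f → v ∉ R.vertexRing) :
    ¬ R.IsCuffFace f := by
  rintro ⟨v, hv, rfl⟩
  exact h v (R.cuffFace_inc ⟨v, hv⟩) hv

variable [Fintype V] [DecidableRel G.Adj] {M : G.Subgraph}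

theorem ncard_vertexInc_and {x : G.Dart × Bool} (hB : E.BoundedByCycle (E.face x))
    (P : V → Prop) [DecidablePred P] : {v | E.VertexInc v (E.face x) ∧ P v}.ncard =
      ∑ i ∈ Finset.range (E.faceLength (E.face x)), if P (E.walkVert x i) then 1 else 0 := by
  classical
  rw [← Finset.card_filter, ← Finset.card_image_of_injOn (f := E.walkVert x),
    ← Set.ncard_coe_finset]
  · congr 1
    ext v
    simp only [Set.mem_ofPred_eq, vertexInc_iff_walkVert, Finset.coe_image, Finset.coe_filter,
      Finset.mem_range, Set.mem_image]
    constructor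
    · rintro ⟨⟨i, hi, rfl⟩, h⟩
      exact ⟨i, ⟨hi, h⟩, rfl⟩
    · rintro ⟨i, ⟨hi, h⟩, rfl⟩
      exact ⟨⟨i, hi, rfl⟩, h⟩
  · intro i hi j hj h
    simp only [Finset.coe_filter, Finset.mem_range, Set.mem_ofPred_eq] at hi hj
    exact hB.walkVert_injOn hi.1 hj.1 h

/-- In a 4-dangerous face, four vertices other than a given one that is not internal of degree
three are all internal of degree three. -/
theorem Dangerous.internalCubic {z : G.Dart × Bool} (hD : R.Dangerous M 4 (E.face z))
    (hB : E.BoundedByCycle (E.face z)) (hz : ¬ R.InternalCubic (E.walkVert z 3))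
    {i : ℕ} (hi : i < 5) (hi3 : i ≠ 3) : R.InternalCubic (E.walkVert z i) := by
  classical
  have h := hD.2.2
  rw [ncard_vertexInc_and hB, hD.1] at h
  simp only [Finset.sum_range_succ, Finset.sum_range_zero, if_neg hz] at h
  by_contra hc
  interval_cases i <;> first
    | exact hi3 rfl
    | (simp only [if_neg hc] at h; split_ifs at h <;> omega)

theorem Extreme.internal {f : E.Face} (h : R.Extreme M f) {v : V} (hv : E.VertexInc v f) :
    R.Internal v := h.2.1 v hv

theorem Extreme.internalFace {f : E.Face} (h : R.Extreme M f) : R.InternalFace f := by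
  obtain ⟨x, rfl⟩ := E.exists_face_eq f
  exact (h.internal (VertexInc.of_flag E x)).internalFace (VertexInc.of_flag E x)

/-- The neighbor of a vertex of degree three outside an extremely 4-dangerous face at this vertex
is not a vertex ring, since the face is opposite to that neighbor. -/
theorem Extreme.third_notMem_vertexRing {x : G.Dart × Bool} (h : R.Extreme M (E.face x))
    (h3 : G.degree x.1.fst = 3) : (E.aroundCorner (E.acrossEdge x)).1.snd ∉ R.vertexRing := by
  intro hv
  refine h.2.2 _ hv ⟨x, rfl, h3, ?_, ?_, ?_⟩
  · have := (E.aroundCorner (E.acrossEdge x)).1.adj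
    simpa using this.symm
  · exact (E.aroundCorner_snd_ne (x := E.acrossEdge x) (by
      change 2 ≤ G.degree x.1.fst; omega)).symm
  · exact (E.aroundCorner_acrossEdge_snd_ne h3.ge).symm

/-- A vertex of degree three on a face without edges of `M` has at most one incident edge in `M`,
hence does not belong to `M`. -/
theorem notMem_verts (hM : M.CapturesShortCycles) {x : G.Dart × Bool}
    (hf : ¬ E.MeetsEdge M (E.face x)) (h3 : G.degree x.1.fst = 3) : x.1.fst ∉ M.verts := by
  intro hv
  have h2 := hM.2 _ hv
  have hsub : M.neighborSet x.1.fst ⊆ {(E.aroundCorner (E.acrossEdge x)).1.snd} := by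
    intro w hw
    rcases E.eq_of_adj_of_degree_eq_three h3 (M.adj_sub hw) with rfl | rfl | h
    · exact absurd hw (not_adj_of_not_meetsEdge hf)
    · have := not_adj_of_not_meetsEdge (E := E) (x := E.aroundCorner x) (by simpa using hf)
      rw [aroundCorner_fst] at this
      exact absurd hw this
    · exact h
  have := Set.ncard_le_ncard hsub
  rw [Set.ncard_singleton] at this
  omega

variable (R M) in
/-- The face of the flag `y` is linked, through the edge of `y`, to the extremely 4-dangerous face
on the other side of that edge. -/
def LinksExtreme (y : G.Dart × Bool) : Prop :=
  R.Extreme M (E.face (E.acrossEdge y)) ∧ ¬ R.InternalCubic (E.walkVert (E.acrossEdge y) 3)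

variable (R M) in
/-- The face of the flag `y` is in the position of the sender in Rule 4 across the edge of `y`: the
face on the other side of this edge is long and is linked to extremely 4-dangerous faces through the
two neighboring edges of its boundary. -/
def BridgesExtreme (y : G.Dart × Bool) : Prop :=
  7 ≤ E.faceLength (E.face (E.acrossEdge y)) ∧
    R.LinksExtreme M (E.aroundCorner (E.acrossEdge y)) ∧
    R.LinksExtreme M (E.aroundCorner (E.acrossEdge (E.alongEdge y)))

namespace LinksExtreme

variable {y : G.Dart × Bool} (hS : R.LinksExtreme M y)
include hS

theorem faceLength : E.faceLength (E.face (E.acrossEdge y)) = 5 := hS.1.1.1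

theorem not_meetsEdge : ¬ E.MeetsEdge M (E.face (E.acrossEdge y)) := hS.1.1.2.1

theorem alongEdge : R.LinksExtreme M (E.alongEdge y) := by
  refine ⟨by rw [acrossEdge_alongEdge, face_alongEdge]; exact hS.1, ?_⟩
  rw [acrossEdge_alongEdge, walkVert_alongEdge _ (j := 2) (by rw [hS.faceLength])]
  exact hS.2

variable (h3 : R.I3)
include h3

theorem boundedByCycle : E.BoundedByCycle (E.face (E.acrossEdge y)) :=
  (h3 _ hS.1.internalFace).1

theorem internalCubic {i : ℕ} (hi : i < 5) (hi3 : i ≠ 3) :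
    R.InternalCubic (E.walkVert (E.acrossEdge y) i) :=
  hS.1.1.internalCubic (hS.boundedByCycle h3) hS.2 hi hi3

theorem fst_internalCubic : R.InternalCubic y.1.fst := hS.internalCubic h3 (i := 0) (by omega)
  (by omega)

theorem snd_internalCubic : R.InternalCubic y.1.snd := hS.alongEdge.fst_internalCubic h3

theorem side_internalCubic : R.InternalCubic (E.aroundCorner (E.acrossEdge y)).1.snd := by
  rw [← walkVert_pred (E.acrossEdge y) (j := 4) (by rw [hS.faceLength])]
  exact hS.internalCubic h3 (by omega) (by omega)

theorem back_notMem_vertexRing : (E.aroundCorner y).1.snd ∉ R.vertexRing := by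
  have := hS.1.third_notMem_vertexRing (x := E.acrossEdge y) (hS.fst_internalCubic h3).2
  rwa [acrossEdge_acrossEdge] at this

theorem fst_notMem_verts (hM : M.CapturesShortCycles) : y.1.fst ∉ M.verts :=
  notMem_verts hM (x := E.acrossEdge y) hS.not_meetsEdge (hS.fst_internalCubic h3).2

theorem side_notMem_verts (hM : M.CapturesShortCycles) :
    (E.aroundCorner (E.acrossEdge y)).1.snd ∉ M.verts :=
  notMem_verts hM (x := E.alongEdge (E.aroundCorner (E.acrossEdge y)))
    (by rw [face_alongEdge, face_aroundCorner]; exact hS.not_meetsEdge) (hS.side_internalCubic h3).2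

/-- A 4-dangerous face is linked through one of its edges only. -/
theorem not_reflect : ¬ R.LinksExtreme M (E.acrossEdge (E.aroundCorner (E.acrossEdge y))) := by
  intro h
  apply h.2
  rw [acrossEdge_acrossEdge, walkVert_aroundCorner _ (j := 2) (by rw [hS.faceLength])]
  exact hS.internalCubic h3 (by omega) (by omega)

end LinksExtreme

namespace BridgesExtreme

variable {y : G.Dart × Bool} (hQ : R.BridgesExtreme M y)
include hQ

theorem alongEdge : R.BridgesExtreme M (E.alongEdge y) := by
  refine ⟨?_, hQ.2.2, ?_⟩
  · rw [acrossEdge_alongEdge, face_alongEdge]; exact hQ.1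
  · rw [alongEdge_alongEdge]; exact hQ.2.1

theorem not_linksExtreme : ¬ R.LinksExtreme M y := fun h => by
  have := hQ.1
  rw [h.faceLength] at this
  omega

variable (h3 : R.I3)
include h3

theorem fst_internalCubic : R.InternalCubic y.1.fst := by
  simpa using hQ.2.1.fst_internalCubic h3

theorem acrossEdge_around : E.acrossEdge (E.aroundCorner (E.acrossEdge (E.aroundCorner
    (E.acrossEdge y)))) = E.aroundCorner y := by
  rw [E.aroundCorner_acrossEdge_cubic (x := E.aroundCorner (E.acrossEdge y))
    ((E.degree_aroundCorner_fst _).trans (hQ.fst_internalCubic h3).2)]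
  simp

theorem not_linksExtreme_aroundCorner : ¬ R.LinksExtreme M (E.aroundCorner y) := by
  have := hQ.2.1.not_reflect h3
  rwa [hQ.acrossEdge_around h3] at this

theorem not_linksExtreme_step : ¬ R.LinksExtreme M (E.step y) :=
  hQ.alongEdge.not_linksExtreme_aroundCorner h3

end BridgesExtreme

variable (R M) in
/-- The positions across which a face may send charge by Rule 3 or Rule 4. -/
def SpendsAcross (y : G.Dart × Bool) : Prop := R.LinksExtreme M y ∨ R.BridgesExtreme M y

namespace SpendsAcross

variable {y : G.Dart × Bool} (hP : R.SpendsAcross M y)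
include hP

theorem alongEdge : R.SpendsAcross M (E.alongEdge y) := hP.imp (·.alongEdge) (·.alongEdge)

variable (h3 : R.I3)
include h3

theorem fst_internalCubic : R.InternalCubic y.1.fst :=
  hP.elim (·.fst_internalCubic h3) (·.fst_internalCubic h3)

theorem snd_internalCubic : R.InternalCubic y.1.snd := hP.alongEdge.fst_internalCubic h3

theorem fst_notMem_verts (hM : M.CapturesShortCycles) : y.1.fst ∉ M.verts := by
  rcases hP with hS | hQ
  · exact hS.fst_notMem_verts h3 hM
  · simpa using hQ.2.1.fst_notMem_verts h3 hM

theorem back_notMem_vertexRing : (E.aroundCorner y).1.snd ∉ R.vertexRing := by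
  rcases hP with hS | hQ
  · exact hS.back_notMem_vertexRing h3
  · have := (hQ.2.1.side_internalCubic h3).1.not_mem_vertexRing
    rwa [← acrossEdge_dart, hQ.acrossEdge_around h3] at this

theorem third_internal : R.Internal (E.aroundCorner (E.acrossEdge y)).1.snd := by
  rcases hP with hS | hQ
  · exact (hS.side_internalCubic h3).1
  · exact (hQ.2.1.snd_internalCubic h3).1

/-- If charge may be sent across the edge of `y`, and the vertex before `y` on the boundary walk is
internal, then the vertex of `y` is internal together with all its neighbors. -/
theorem internal_of_adj (hb : R.Internal (E.aroundCorner y).1.snd) {w : V}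
    (hw : G.Adj y.1.fst w) : R.Internal w := by
  rcases E.eq_of_adj_of_degree_eq_three (hP.fst_internalCubic h3).2 hw with rfl | rfl | rfl
  · exact (hP.snd_internalCubic h3).1
  · exact hb
  · exact hP.third_internal h3

end SpendsAcross

end Local

end Rings

end EmbeddingScheme

/-! ### The configurations `R4` and `R5` -/

namespace EmbeddingScheme

namespace Rings

section Reducible

variable {V : Type*} {G : SimpleGraph V} {E : EmbeddingScheme G} {R : E.Rings}
  [Fintype V] [DecidableRel G.Adj] {M : G.Subgraph}

theorem acrossEdge_step_acrossEdge {y : G.Dart × Bool} (h : G.degree y.1.snd = 3) :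
    E.acrossEdge (E.step (E.acrossEdge y)) = E.aroundCorner (E.acrossEdge (E.step y)) := by
  have := E.aroundCorner_acrossEdge_cubic (x := E.alongEdge y) h
  rw [acrossEdge_alongEdge] at this
  exact this

/-- Around two consecutive edges of a long face, the configuration `R5` is formed by an extremely
4-dangerous face at the first edge and a 5-face at the second one. -/
theorem false_of_r5 (h3 : R.I3) (hM : M.CapturesShortCycles)
    (hconf : ∀ c : E.ConfigCopy, R.Appears c → c.Touches M) {y : G.Dart × Bool}
    (hL : 7 ≤ E.faceLength (E.face y)) (hS : R.LinksExtreme M y)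
    (hlen : E.faceLength (E.face (E.acrossEdge (E.step y))) = 5)
    (hMh : ¬ E.MeetsEdge M (E.face (E.acrossEdge (E.step y))))
    (hc1 : R.InternalCubic (E.walkVert y 2))
    (hc2 : R.InternalCubic (E.walkVert (E.acrossEdge (E.step y)) 2)) : False := by
  have hv := hS.snd_internalCubic h3
  have hg := hS.boundedByCycle h3
  have hgL := hS.faceLength
  have hgM := hS.not_meetsEdge
  have hgE := hS.1
  have hhI : R.InternalFace (E.face (E.acrossEdge (E.step y))) :=
    hv.1.internalFace ⟨_, rfl, by simp⟩
  have hh := (h3 _ hhI).1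
  -- `q` is the flag of the 4-dangerous face at the edge that it shares with the other 5-face.
  obtain ⟨q, hq⟩ : ∃ q, q = E.step (E.acrossEdge y) := ⟨_, rfl⟩
  have hfq : E.face (E.acrossEdge y) = E.face q := by rw [hq, face_step]
  have hbq : E.acrossEdge q = E.aroundCorner (E.acrossEdge (E.step y)) := by
    rw [hq]; exact acrossEdge_step_acrossEdge hv.2
  have hfh : E.face (E.acrossEdge (E.step y)) = E.face (E.acrossEdge q) := by
    rw [hbq, face_aroundCorner]
  have q4 : E.walkVert q 4 = y.1.fst := by
    rw [hq, walkVert_step, walkVert_five hgL]; rfl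
  have cq : ∀ i < 5, i ≠ 2 → R.InternalCubic (E.walkVert q i) := by
    intro i hi hi2
    by_cases h4 : i = 4
    · rw [h4, q4]; exact hS.fst_internalCubic h3
    · rw [hq, walkVert_step]; exact hS.internalCubic h3 (by omega) (by omega)
  have t0 : E.walkVert (E.acrossEdge q) 0 = E.walkVert q 0 := rfl
  have t1 : E.walkVert (E.acrossEdge q) 1 = E.walkVert q 1 := by simp [walkVert_one]
  have t4 : E.walkVert (E.acrossEdge q) 4 = E.walkVert y 2 := by
    rw [hbq, walkVert_aroundCorner _ (j := 1) (by rw [hlen]), walkVert_one, acrossEdge_dart,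
      ← walkVert_one, walkVert_step]
  have t3 : E.walkVert (E.acrossEdge q) 3 = E.walkVert (E.acrossEdge (E.step y)) 2 := by
    rw [hbq, walkVert_aroundCorner _ (j := 2) (by rw [hlen])]
  rw [← t3] at hc2
  rw [← t4] at hc1
  clear t3
  have hqy : E.walkVert q 0 = E.walkVert y 1 := by
    rw [hq, walkVert_step, walkVert_one, walkVert_one, acrossEdge_dart]
  rw [hfq] at hg hgL hgM hgE
  rw [hfh] at hlen hMh hhI hh
  have c0 := cq 0 (by omega) (by omega)
  have c1 := cq 1 (by omega) (by omega)
  have c3 := cq 3 (by omega) (by omega)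
  have c4 := cq 4 (by omega) (by omega)
  have t2 : E.walkVert (E.acrossEdge q) 2 ∉ R.vertexRing := by
    rw [walkVert_two, ← acrossEdge_alongEdge]
    refine Extreme.third_notMem_vertexRing (M := M) (x := E.alongEdge q)
      (by rwa [face_alongEdge]) ?_
    have := c1.2
    rwa [walkVert_one] at this
  have hcuff : ¬ R.IsCuffFace (E.face (E.acrossEdge q)) := by
    refine not_isCuffFace fun v hv => ?_
    obtain ⟨i, hi, rfl⟩ := vertexInc_iff_walkVert.mp hv
    rw [hlen] at hi
    interval_cases i
    · rw [t0]; exact c0.1.not_mem_vertexRing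
    · rw [t1]; exact c1.1.not_mem_vertexRing
    · exact t2
    · exact hc2.1.not_mem_vertexRing
    · exact hc1.1.not_mem_vertexRing
  have hcuff' : ¬ R.IsCuffFace (E.face q) :=
    not_isCuffFace fun v hv => (hgE.internal hv).not_mem_vertexRing
  have hnod := two_pentagons_nodup hM hg hgL hgM hh hlen hMh
    (by have := c0.2; rw [walkVert_zero] at this; omega)
    (by have := c1.2; rw [walkVert_one] at this; omega)
  have hi2 : R.Internal (E.walkVert q 2) := hgE.internal (vertexInc_walkVert q 2)
  have trg := (traces_five hgL).rotate_five
  have trh := (traces_five hlen).rotate_five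
  rw [t0, t1] at trh
  have q3 : E.walkVert q 3 = (E.aroundCorner (E.acrossEdge y)).1.snd := by
    rw [hq, walkVert_step]
    exact walkVert_pred _ (by rw [hS.faceLength])
  have hd := (hS.fst_internalCubic h3).2
  have happ := Appears.r5 (R := R) (E.face q) (E.face (E.acrossEdge q)) (E.face y)
    (E.walkVert (E.acrossEdge q) 3) (E.walkVert (E.acrossEdge q) 2) (E.walkVert q 1)
    (E.walkVert q 2) (E.walkVert q 3) (E.walkVert q 4) (E.walkVert q 0)
    (E.walkVert (E.acrossEdge q) 4) (E.aroundCorner y).1.snd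
    ⟨⟨by
      simp only [copyR5]
      simp only [List.nodup_cons, List.mem_cons, List.not_mem_nil, or_false, not_or,
        not_false_eq_true, and_true, List.nodup_nil] at hnod ⊢
      clear * - hnod
      grind, by
      simp only [copyR5, List.mem_cons, List.not_mem_nil, or_false]
      rintro p (rfl | rfl)
      · exact ⟨hgE.internalFace, hcuff', trg⟩
      · exact ⟨hhI, hcuff, trh⟩, by
      simp only [copyR5, List.mem_cons, List.not_mem_nil, or_false]
      rintro p (rfl | rfl | rfl | rfl | rfl | rfl) <;> assumption, by
      simp only [copyR5, List.mem_cons, List.not_mem_nil, or_false]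
      rintro u (rfl | rfl) v (rfl | rfl) huv
      · exact absurd rfl huv
      · exact Or.inl hi2
      · exact Or.inr hi2
      · exact absurd rfl huv⟩, by
      simp only [copyR5, List.mem_cons, List.not_mem_nil, or_false]
      rintro u (rfl | rfl)
      · exact hi2.not_mem_vertexRing
      · exact hS.back_notMem_vertexRing h3⟩
    (by rw [q4, ← aroundCorner_fst E y]; exact (E.aroundCorner y).1.adj)
    (by rw [q3]; exact (E.aroundCorner_acrossEdge_snd_ne hd.ge).symm)
    (by rw [hqy, walkVert_one]; exact E.aroundCorner_snd_ne (by omega))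
    hi2
    ⟨y, rfl, q4.symm, by rw [hqy, walkVert_one, step_fst], by rw [t4]; rfl⟩ hL
  obtain ⟨p, hp, hpM⟩ := hconf _ happ
  simp only [copyR5, List.mem_cons, List.not_mem_nil, or_false] at hp
  rcases hp with rfl | rfl
  · exact hgM hpM
  · exact hMh hpM

/-- A face of length at least seven is not linked to extremely 4-dangerous faces through two
consecutive edges. -/
theorem LinksExtreme.not_step (h3 : R.I3) (hM : M.CapturesShortCycles)
    (hconf : ∀ c : E.ConfigCopy, R.Appears c → c.Touches M) {y : G.Dart × Bool}
    (hL : 7 ≤ E.faceLength (E.face y)) (hS : R.LinksExtreme M y) :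
    ¬ R.LinksExtreme M (E.step y) := by
  intro hS'
  refine false_of_r5 h3 hM hconf hL hS hS'.faceLength hS'.not_meetsEdge ?_
    (hS'.internalCubic h3 (by omega) (by omega))
  have := hS'.snd_internalCubic h3
  rwa [← walkVert_one, walkVert_step] at this

/-- If a face of length at least seven is linked to extremely 4-dangerous faces through the first
and the third of three consecutive edges, then the face across the second one is long, so Rule 4
applies. -/
theorem LinksExtreme.six_le (h3 : R.I3) (hM : M.CapturesShortCycles)
    (hconf : ∀ c : E.ConfigCopy, R.Appears c → c.Touches M) {y : G.Dart × Bool}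
    (hL : 7 ≤ E.faceLength (E.face y)) (hS : R.LinksExtreme M y)
    (hS' : R.LinksExtreme M (E.step (E.step y))) :
    6 ≤ E.faceLength (E.face (E.acrossEdge (E.step y))) := by
  by_contra hlt
  have hv := hS.snd_internalCubic h3
  have hhI : R.InternalFace (E.face (E.acrossEdge (E.step y))) :=
    hv.1.internalFace ⟨_, rfl, by simp⟩
  have hlen : E.faceLength (E.face (E.acrossEdge (E.step y))) = 5 := by
    have := (h3 _ hhI).2
    omega
  set p := E.acrossEdge (E.step y) with hp
  have p0 : E.walkVert p 0 = y.1.snd := by rw [walkVert_zero, hp, acrossEdge_dart, step_fst]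
  have p1 : E.walkVert p 1 = (E.step (E.step y)).1.fst := by
    rw [walkVert_one, hp, acrossEdge_dart, ← step_fst]
  have hd := hS'.fst_internalCubic h3
  have p2 : E.walkVert p 2 = (E.aroundCorner (E.acrossEdge (E.step (E.step y)))).1.snd := by
    have h1 : E.alongEdge p = E.acrossEdge (E.aroundCorner (E.step (E.step y))) := by
      rw [hp, aroundCorner_step, acrossEdge_alongEdge]
    rw [walkVert_two, h1, ← E.aroundCorner_acrossEdge_cubic hd.2, acrossEdge_dart]
  have p4 : E.walkVert p 4 = (E.aroundCorner (E.acrossEdge (E.alongEdge y))).1.snd := by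
    rw [walkVert_pred _ (by rw [hlen]), hp]
    have h1 := E.aroundCorner_acrossEdge_cubic (x := E.alongEdge y) hv.2
    rw [show E.aroundCorner (E.alongEdge y) = E.step y from rfl] at h1
    rw [← h1, acrossEdge_dart]
  have m0 : E.walkVert p 0 ∉ M.verts := by
    rw [p0]; exact hS.alongEdge.fst_notMem_verts h3 hM
  have m1 : E.walkVert p 1 ∉ M.verts := by rw [p1]; exact hS'.fst_notMem_verts h3 hM
  have m2 : E.walkVert p 2 ∉ M.verts := by rw [p2]; exact hS'.side_notMem_verts h3 hM
  have m4 : E.walkVert p 4 ∉ M.verts := by rw [p4]; exact hS.alongEdge.side_notMem_verts h3 hM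
  refine false_of_r5 h3 hM hconf hL hS hlen ?_ hd ?_
  · rintro ⟨e, he, hinc⟩
    obtain ⟨i, hi, rfl⟩ := edgeInc_iff.mp hinc
    rw [iterate_step_edge, SimpleGraph.Subgraph.mem_edgeSet] at he
    have hl := M.edge_vert he
    have hr := M.edge_vert he.symm
    rw [hlen] at hi
    interval_cases i
    · exact m0 hl
    · exact m1 hl
    · exact m2 hl
    · exact m4 hr
    · exact m4 hl
  · rw [p2]; exact hS'.side_internalCubic h3

/-- The face linked to an extremely 4-dangerous face is long, or meets an edge of `M`, or is a cuff
face, since otherwise the two faces form the configuration `R4`. -/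
theorem Extreme.linked_face (h0 : R.I0) (h3 : R.I3) (hM : M.CapturesShortCycles)
    (hconf : ∀ c : E.ConfigCopy, R.Appears c → c.Touches M) {z : G.Dart × Bool}
    (hE : R.Extreme M (E.face z)) (hz : ¬ R.InternalCubic (E.walkVert z 3)) :
    6 ≤ E.faceLength (E.face (E.acrossEdge z)) ∨
      (E.faceLength (E.face (E.acrossEdge z)) = 5 ∧
      (E.MeetsEdge M (E.face (E.acrossEdge z)) ∨ R.IsCuffFace (E.face (E.acrossEdge z)))) := by
  have hg := (h3 _ hE.internalFace).1
  have hgL := hE.1.1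
  have hgM := hE.1.2.1
  have c : ∀ i < 5, i ≠ 3 → R.InternalCubic (E.walkVert z i) := fun i hi hi3 =>
    hE.1.internalCubic hg hz hi hi3
  have c0 := c 0 (by omega) (by omega)
  have c1 := c 1 (by omega) (by omega)
  have c2 := c 2 (by omega) (by omega)
  have c4 := c 4 (by omega) (by omega)
  have hhI : R.InternalFace (E.face (E.acrossEdge z)) := c0.1.internalFace ⟨_, rfl, rfl⟩
  have hh := (h3 _ hhI).1
  by_contra! hcon
  have hlen : E.faceLength (E.face (E.acrossEdge z)) = 5 := by
    have := (h3 _ hhI).2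
    omega
  obtain ⟨hMh, hcuff⟩ := hcon.2 hlen
  have hnod := two_pentagons_nodup hM hg hgL hgM hh hlen hMh
    (by have := c0.2; rw [walkVert_zero] at this; omega)
    (by have := c1.2; rw [walkVert_one] at this; omega)
  have hcuff' : ¬ R.IsCuffFace (E.face z) :=
    not_isCuffFace fun v hv => (hE.internal hv).not_mem_vertexRing
  have hi3 : R.Internal (E.walkVert z 3) := hE.internal (vertexInc_walkVert z 3)
  have t0 : E.walkVert (E.acrossEdge z) 0 = E.walkVert z 0 := rfl
  have t1 : E.walkVert (E.acrossEdge z) 1 = E.walkVert z 1 := by simp [walkVert_one]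
  have trg := (traces_five hgL).rotate_five.rotate_five
  have trh := (traces_five hlen).reflect_five
  rw [t0, t1] at trh
  have happ := Appears.r4 (R := R) (E.face z) (E.face (E.acrossEdge z))
    (E.walkVert z 2) (E.walkVert z 3) (E.walkVert z 4) (E.walkVert z 0) (E.walkVert z 1)
    (E.walkVert (E.acrossEdge z) 4) (E.walkVert (E.acrossEdge z) 3)
    (E.walkVert (E.acrossEdge z) 2)
    ⟨⟨by
      simp only [copyR4]
      simp only [List.nodup_cons, List.mem_cons, List.not_mem_nil, or_false, not_or,
        not_false_eq_true, and_true, List.nodup_nil] at hnod ⊢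
      clear * - hnod
      grind, by
      simp only [copyR4, List.mem_cons, List.not_mem_nil, or_false]
      rintro p (rfl | rfl)
      · exact ⟨hE.internalFace, hcuff', trg⟩
      · exact ⟨hhI, hcuff, trh⟩, by
      simp only [copyR4, List.mem_cons, List.not_mem_nil, or_false]
      rintro p (rfl | rfl | rfl | rfl) <;> assumption, by
      simp [copyR4]⟩, by
      simp [copyR4]⟩
    hi3
    (by
      have h3' := h0 _ hi3
      have h4 : G.degree (E.walkVert z 3) ≠ 3 := fun h => hz ⟨hi3, h⟩
      omega)
    (by
      rw [walkVert_pred _ (by rw [hlen])]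
      exact hE.third_notMem_vertexRing c0.2)
    (by
      rw [walkVert_two, ← acrossEdge_alongEdge]
      refine Extreme.third_notMem_vertexRing (M := M) (x := E.alongEdge z)
        (by rwa [face_alongEdge]) ?_
      have := c1.2
      rwa [walkVert_one] at this)
  obtain ⟨p, hp, hpM⟩ := hconf _ happ
  simp only [copyR4, List.mem_cons, List.not_mem_nil, or_false] at hp
  rcases hp with rfl | rfl
  · exact hgM hpM
  · exact hMh hpM

end Reducible

end Rings

end EmbeddingScheme

/-! ### Counting the charge along the boundary walk -/

namespace EmbeddingScheme

namespace Rings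

section Counting

variable {V : Type*} {G : SimpleGraph V} {E : EmbeddingScheme G} {R : E.Rings}
  [Fintype V] [DecidableRel G.Adj] {M : G.Subgraph}

variable (R) in
/-- The vertices that receive charge by Rule 1 from all incident internal faces. -/
def Receiving (v : V) : Prop := (G.degree v = 2 ∧ R.OnFacial v) ∨ R.InternalCubic v

theorem linksExtreme_of_linkedThrough {y : G.Dart × Bool} (hB : E.BoundedByCycle (E.face y))
    {g : E.Face} (hE : R.Extreme M g) (hl : R.LinkedThrough M (E.face y) g y.1.edge) :
    R.LinksExtreme M y ∧ g = E.face (E.acrossEdge y) := by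
  obtain ⟨-, z, rfl, hze, hz, hzf⟩ := hl
  have hne := hB.face_acrossEdge_ne
  rcases E.eq_or_eq_of_edge_eq hze with (rfl | rfl) | (rfl | rfl)
  · exact absurd hzf hne
  · rw [acrossEdge_alongEdge, face_alongEdge] at hzf
    exact absurd hzf hne
  · exact ⟨⟨hE, hz⟩, rfl⟩
  · rw [face_alongEdge] at hE ⊢
    have hS : R.LinksExtreme M (E.alongEdge y) :=
      ⟨by rwa [acrossEdge_alongEdge, face_alongEdge], by rwa [acrossEdge_alongEdge]⟩
    exact ⟨by simpa using hS.alongEdge, rfl⟩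

theorem LinksExtreme.linkedThrough {y : G.Dart × Bool} (hS : R.LinksExtreme M y) :
    R.LinkedThrough M (E.face y) (E.face (E.acrossEdge y)) y.1.edge :=
  ⟨hS.1.1, E.acrossEdge y, rfl, rfl, hS.2, by rw [acrossEdge_acrossEdge]⟩

theorem Rule3.exists_linksExtreme {x : G.Dart × Bool} (hB : E.BoundedByCycle (E.face x))
    {p : E.Face × Sym2 V} (h : R.Rule3 M (E.face x) p.1 p.2) :
    ∃ i < E.faceLength (E.face x), R.LinksExtreme M (E.step^[i] x) ∧
      (E.face (E.acrossEdge (E.step^[i] x)), (E.step^[i] x).1.edge) = p := by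
  obtain ⟨g, e⟩ := p
  obtain ⟨hE, hl, -⟩ := h
  have hinc : E.EdgeInc e (E.face x) := by
    obtain ⟨-, z, -, hze, -, hzf⟩ := hl
    exact ⟨E.acrossEdge z, hzf, hze⟩
  obtain ⟨i, hi, rfl⟩ := edgeInc_iff.mp hinc
  have hB' : E.BoundedByCycle (E.face (E.step^[i] x)) := by simpa using hB
  obtain ⟨hS, rfl⟩ := linksExtreme_of_linkedThrough hB' hE (by simpa using hl)
  exact ⟨i, hi, hS, rfl⟩

theorem Rule4.exists_bridgesExtreme (h3 : R.I3) {x : G.Dart × Bool}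
    {p : E.Face × Sym2 V} (h : R.Rule4 M (E.face x) p.1 p.2) :
    ∃ i < E.faceLength (E.face x), R.BridgesExtreme M (E.step^[i] x) ∧
      (E.face (E.acrossEdge (E.step^[i] x)), (E.step^[i] x).1.edge) = p := by
  obtain ⟨g, e⟩ := p
  obtain ⟨hgI, hgL, -, z, rfl, rfl, hzf, ⟨g₁, hE₁, hl₁⟩, g₂, hE₂, hl₂⟩ := h
  have hB := (h3 _ hgI).1
  have hS₁ := (linksExtreme_of_linkedThrough hB hE₁ hl₁).1
  have hS₂ := (linksExtreme_of_linkedThrough (y := E.step (E.step z)) (by simpa using hB) hE₂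
    (by simpa using hl₂)).1
  have hQ : R.BridgesExtreme M (E.acrossEdge (E.step z)) := by
    refine ⟨by simpa using hgL, ?_, ?_⟩
    · rw [acrossEdge_acrossEdge, aroundCorner_step]
      exact hS₁.alongEdge
    · rw [acrossEdge_alongEdge, acrossEdge_acrossEdge]
      exact hS₂
  obtain ⟨i, hi, h | h⟩ := face_eq_iff_alongEdge.mp hzf
  · rw [h] at hQ
    refine ⟨i, hi, hQ, ?_⟩
    rw [← h]
    simp
  · rw [h] at hQ
    refine ⟨i, hi, by simpa using hQ.alongEdge, ?_⟩
    have h' : E.step^[i] x = E.alongEdge (E.acrossEdge (E.step z)) := by rw [h]; simp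
    rw [h', acrossEdge_alongEdge]
    simp

theorem ncard_le_sum {α : Type*} {A : Set α} {n : ℕ} {F : ℕ → α} {P : ℕ → Prop}
    [DecidablePred P] (h : ∀ a ∈ A, ∃ i < n, P i ∧ F i = a) :
    A.ncard ≤ ∑ i ∈ Finset.range n, if P i then 1 else 0 := by
  classical
  rw [← Finset.card_filter]
  calc A.ncard ≤ ((((Finset.range n).filter P).image F : Finset α) : Set α).ncard := by
        refine Set.ncard_le_ncard (fun a ha => ?_) (Finset.finite_toSet _)
        obtain ⟨i, hi, hP, rfl⟩ := h a ha
        exact Finset.mem_coe.mpr (Finset.mem_image_of_mem F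
          (Finset.mem_filter.mpr ⟨Finset.mem_range.mpr hi, hP⟩))
    _ ≤ _ := by rw [Set.ncard_coe_finset]; exact Finset.card_image_le

theorem sum_le_ncard {α : Type*} {A : Set α} (hA : A.Finite) {n : ℕ} {F : ℕ → α}
    {P : ℕ → Prop} [DecidablePred P] (h : ∀ i < n, P i → F i ∈ A)
    (hF : ∀ i < n, ∀ j < n, F i = F j → i = j) :
    (∑ i ∈ Finset.range n, if P i then 1 else 0) ≤ A.ncard := by
  classical
  rw [← Finset.card_filter, ← Finset.card_image_of_injOn (f := F), ← Set.ncard_coe_finset]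
  · refine Set.ncard_le_ncard (fun a ha => ?_) hA
    obtain ⟨i, hi, rfl⟩ := Finset.mem_image.mp (Finset.mem_coe.mp ha)
    rw [Finset.mem_filter, Finset.mem_range] at hi
    exact h i hi.1 hi.2
  · intro i hi j hj hij
    simp only [Finset.coe_filter, Finset.mem_range, Set.mem_ofPred_eq] at hi hj
    exact hF i hi.1 j hj.1 hij

open Classical in
theorem ncard_rule1 (h3 : R.I3) {x : G.Dart × Bool} (hf : R.InternalFace (E.face x)) :
    {v | R.Rule1 (E.face x) v}.ncard =
      ∑ i ∈ Finset.range (E.faceLength (E.face x)),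
        if R.Receiving (E.walkVert x i) then 1 else 0 := by
  rw [← ncard_vertexInc_and (h3 _ hf).1]
  congr 1
  ext v
  simp [Rule1, Receiving, hf]

open Classical in
/-- A lower bound for the charge of a face in terms of its boundary walk: charge is sent to the
receiving vertices, and across edges only in the positions of Rule 3 and Rule 4. -/
theorem le_primaryCharge (h3 : R.I3) {x : G.Dart × Bool} (hf : R.InternalFace (E.face x)) :
    R.initialCharge M (E.face x)
      - 1 / 3 * ((∑ i ∈ Finset.range (E.faceLength (E.face x)),
          if R.Receiving (E.walkVert x i) then 1 else 0 : ℕ) : ℝ)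
      - 1 / 3 * ((∑ i ∈ Finset.range (E.faceLength (E.face x)),
          if R.LinksExtreme M (E.step^[i] x) then 1 else 0 : ℕ) : ℝ)
      - 1 / 9 * ((∑ i ∈ Finset.range (E.faceLength (E.face x)),
          if R.BridgesExtreme M (E.step^[i] x) then 1 else 0 : ℕ) : ℝ)
      + 1 / 3 * {v | R.Rule2Inc v (E.face x)}.ncard
      + 8 / 9 * {v | R.IsCuffFaceOf (E.face x) v}.ncard
      + 1 / 9 * {p : E.Face × Sym2 V | R.Rule4 M p.1 (E.face x) p.2}.ncard
    ≤ R.primaryCharge M (E.face x) := by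
  have hB := (h3 _ hf).1
  have hs : ({p : E.Face × Sym2 V | R.Rule3 M (E.face x) p.1 p.2}.ncard : ℝ) ≤ _ :=
    Nat.cast_le.mpr (ncard_le_sum (P := fun i => R.LinksExtreme M (E.step^[i] x))
      fun p hp => Rule3.exists_linksExtreme hB hp)
  have hq : ({p : E.Face × Sym2 V | R.Rule4 M (E.face x) p.1 p.2}.ncard : ℝ) ≤ _ :=
    Nat.cast_le.mpr (ncard_le_sum (P := fun i => R.BridgesExtreme M (E.step^[i] x))
      fun p hp => Rule4.exists_bridgesExtreme h3 hp)
  rw [primaryCharge, ncard_rule1 h3 hf]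
  have h2 : (0 : ℝ) ≤ {v | R.Rule2Facial M v (E.face x)}.ncard := Nat.cast_nonneg _
  have h4 : (0 : ℝ) ≤ {v | R.Rule2Opp v (E.face x)}.ncard := Nat.cast_nonneg _
  have h5 : (0 : ℝ) ≤ {p : E.Face × Sym2 V | R.Rule3 M p.1 (E.face x) p.2}.ncard :=
    Nat.cast_nonneg _
  linarith

open Classical in
/-- A coarser bound that charges `1/3` to every edge across which anything may be sent. -/
theorem le_primaryCharge_of_spendsAcross (h3 : R.I3) {x : G.Dart × Bool}
    (hf : R.InternalFace (E.face x)) :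
    R.initialCharge M (E.face x)
      - 1 / 3 * ((∑ i ∈ Finset.range (E.faceLength (E.face x)),
          if R.Receiving (E.walkVert x i) then 1 else 0 : ℕ) : ℝ)
      - 1 / 3 * ((∑ i ∈ Finset.range (E.faceLength (E.face x)),
          if R.SpendsAcross M (E.step^[i] x) then 1 else 0 : ℕ) : ℝ)
      + 1 / 3 * {v | R.Rule2Inc v (E.face x)}.ncard
      + 8 / 9 * {v | R.IsCuffFaceOf (E.face x) v}.ncard
    ≤ R.primaryCharge M (E.face x) := by
  refine le_trans ?_ (le_primaryCharge h3 hf)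
  have hsum : (∑ i ∈ Finset.range (E.faceLength (E.face x)),
        if R.LinksExtreme M (E.step^[i] x) then 1 else 0) +
      (∑ i ∈ Finset.range (E.faceLength (E.face x)),
        if R.BridgesExtreme M (E.step^[i] x) then 1 else 0) ≤
      ∑ i ∈ Finset.range (E.faceLength (E.face x)),
        if R.SpendsAcross M (E.step^[i] x) then 1 else 0 := by
    rw [← Finset.sum_add_distrib]
    refine Finset.sum_le_sum fun i _ => ?_
    by_cases hs : R.LinksExtreme M (E.step^[i] x)
    · have hq : ¬ R.BridgesExtreme M (E.step^[i] x) := fun h => h.not_linksExtreme hs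
      simp [SpendsAcross, hs, hq]
    · simp [SpendsAcross, hs]
  have hsum' := (Nat.cast_le (α := ℝ)).mpr hsum
  rw [Nat.cast_add] at hsum'
  have h4 : (0 : ℝ) ≤ {p : E.Face × Sym2 V | R.Rule4 M p.1 (E.face x) p.2}.ncard :=
    Nat.cast_nonneg _
  have h5 : (0 : ℝ) ≤ ((∑ i ∈ Finset.range (E.faceLength (E.face x)),
    if R.BridgesExtreme M (E.step^[i] x) then 1 else 0 : ℕ) : ℝ) := Nat.cast_nonneg _
  linarith

theorem sum_range_shift {n : ℕ} {a : ℕ → ℕ} (h : a n = a 0) :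
    ∑ i ∈ Finset.range n, a (i + 1) = ∑ i ∈ Finset.range n, a i := by
  have h1 := Finset.sum_range_succ a n
  have h2 := Finset.sum_range_succ' a n
  omega

open Classical in
/-- A long face sends, on average over its edges, at most `1/9` across each edge: charge sent across
an edge by Rule 3 is split between this edge and its two neighbors, and if an edge gets two such
shares then Rule 4 returns one of them. -/
theorem le_primaryCharge_of_seven_le (h3 : R.I3) (hM : M.CapturesShortCycles)
    (hconf : ∀ c : E.ConfigCopy, R.Appears c → c.Touches M) {x : G.Dart × Bool}
    (hf : R.InternalFace (E.face x)) (hL : 7 ≤ E.faceLength (E.face x)) :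
    R.initialCharge M (E.face x)
      - 1 / 3 * ((∑ i ∈ Finset.range (E.faceLength (E.face x)),
          if R.Receiving (E.walkVert x i) then 1 else 0 : ℕ) : ℝ)
      - E.faceLength (E.face x) / 9
    ≤ R.primaryCharge M (E.face x) := by
  refine le_trans ?_ (le_primaryCharge h3 hf)
  set n := E.faceLength (E.face x) with hn
  let s : ℕ → ℕ := fun i => if R.LinksExtreme M (E.step^[i] x) then 1 else 0
  let q : ℕ → ℕ := fun i => if R.BridgesExtreme M (E.step^[i] x) then 1 else 0
  let r : ℕ → ℕ := fun i =>
    if R.LinksExtreme M (E.step^[i] x) ∧ R.LinksExtreme M (E.step^[i + 2] x) then 1 else 0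
  have hper : ∀ k, E.step^[n + k] x = E.step^[k] x := fun k => by
    rw [Nat.add_comm, Function.iterate_add_apply, hn, iterate_faceLength]
  have hr : ∑ i ∈ Finset.range n, r i ≤
      {p : E.Face × Sym2 V | R.Rule4 M p.1 (E.face x) p.2}.ncard := by
    refine sum_le_ncard (Set.toFinite _)
      (F := fun i => (E.face (E.acrossEdge (E.step^[i + 1] x)), (E.step^[i + 1] x).1.edge))
      (fun i _ hi => ?_) fun i hi j hj hij => ?_
    · have hstep : E.step^[i + 1] x = E.step (E.step^[i] x) := Function.iterate_succ_apply' ..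
      have hstep' : E.step^[i + 2] x = E.step (E.step (E.step^[i] x)) := by
        rw [Function.iterate_succ_apply', hstep]
      rw [hstep'] at hi
      have h6 := hi.1.six_le h3 hM hconf (by simpa using hL) hi.2
      have hl₁ := hi.1.linkedThrough
      have hl₂ := hi.2.linkedThrough
      simp only [face_step, face_iterate_step] at hl₁ hl₂
      refine ⟨hf, hL, by rwa [hstep], E.step^[i] x, by simp, by rw [hstep], by rw [hstep],
        ⟨_, hi.1.1, hl₁⟩, ⟨_, hi.2.1, hl₂⟩⟩
    · have hB : E.BoundedByCycle (E.face (E.step x)) := by simpa using (h3 _ hf).1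
      exact hB.iterate_edge_injOn (by simpa using hi) (by simpa using hj)
        (congrArg Prod.snd hij)
  -- the share of the edge `i + 1`
  have hpt : ∀ i, s i + s (i + 1) + s (i + 2) + q (i + 1) ≤ 1 + r i := by
    intro i
    have hstep : E.step^[i + 1] x = E.step (E.step^[i] x) := Function.iterate_succ_apply' ..
    have hstep' : E.step^[i + 2] x = E.step (E.step^[i + 1] x) := Function.iterate_succ_apply' ..
    have n1 : R.LinksExtreme M (E.step^[i] x) → ¬ R.LinksExtreme M (E.step^[i + 1] x) := by
      intro h
      rw [hstep]
      exact h.not_step h3 hM hconf (by simpa using hL)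
    have n2 : R.LinksExtreme M (E.step^[i + 1] x) → ¬ R.LinksExtreme M (E.step^[i + 2] x) := by
      intro h
      rw [hstep']
      exact h.not_step h3 hM hconf (by simpa using hL)
    have n3 : R.BridgesExtreme M (E.step^[i + 1] x) → ¬ R.LinksExtreme M (E.step^[i] x) := by
      intro h h'
      refine h.not_linksExtreme_aroundCorner h3 ?_
      rw [hstep, aroundCorner_step]
      exact h'.alongEdge
    have n4 : R.BridgesExtreme M (E.step^[i + 1] x) → ¬ R.LinksExtreme M (E.step^[i + 1] x) :=
      fun h => h.not_linksExtreme
    have n5 : R.BridgesExtreme M (E.step^[i + 1] x) → ¬ R.LinksExtreme M (E.step^[i + 2] x) := by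
      intro h
      rw [hstep']
      exact h.not_linksExtreme_step h3
    simp only [s, q, r]
    by_cases a : R.LinksExtreme M (E.step^[i] x) <;>
      by_cases b : R.LinksExtreme M (E.step^[i + 1] x) <;>
      by_cases c : R.LinksExtreme M (E.step^[i + 2] x) <;>
      by_cases d : R.BridgesExtreme M (E.step^[i + 1] x) <;> simp_all
  have hs1 : ∑ i ∈ Finset.range n, s (i + 1) = ∑ i ∈ Finset.range n, s i :=
    sum_range_shift (by simp only [s]; rw [show n = n + 0 from rfl, hper])
  have hs2 : ∑ i ∈ Finset.range n, s (i + 2) = ∑ i ∈ Finset.range n, s i :=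
    (sum_range_shift (a := fun i => s (i + 1)) (by simp only [s]; rw [hper])).trans hs1
  have hq1 : ∑ i ∈ Finset.range n, q (i + 1) = ∑ i ∈ Finset.range n, q i :=
    sum_range_shift (by simp only [q]; rw [show n = n + 0 from rfl, hper])
  have htot := Finset.sum_le_sum fun i (_ : i ∈ Finset.range n) => hpt i
  simp only [Finset.sum_add_distrib, hs1, hs2, hq1, Finset.sum_const, Finset.card_range,
    smul_eq_mul, mul_one] at htot
  have htot' : 3 * (∑ i ∈ Finset.range n, s i) + (∑ i ∈ Finset.range n, q i) ≤
      n + {p : E.Face × Sym2 V | R.Rule4 M p.1 (E.face x) p.2}.ncard := by omega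
  have htot'' := (Nat.cast_le (α := ℝ)).mpr htot'
  simp only [Nat.cast_add, Nat.cast_mul, Nat.cast_ofNat] at htot''
  have h1 : (0 : ℝ) ≤ {v | R.Rule2Inc v (E.face x)}.ncard := Nat.cast_nonneg _
  have h2 : (0 : ℝ) ≤ {v | R.IsCuffFaceOf (E.face x) v}.ncard := Nat.cast_nonneg _
  simp only [s, q] at htot''
  push_cast at htot'' ⊢
  linarith

end Counting

end Rings

end EmbeddingScheme

/-! ### Faces with edges of `M` or a cuff, and the configurations `R1`, `R2` and `R3` -/

namespace EmbeddingScheme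

namespace Rings

section Faces

variable {V : Type*} {G : SimpleGraph V} {E : EmbeddingScheme G} {R : E.Rings}
  {M : G.Subgraph}

theorem exists_walk_start {f : E.Face} {v : V} (h : E.VertexInc v f) :
    ∃ x, E.face x = f ∧ E.walkVert x 0 = v := h

theorem iterate_step_add (x : G.Dart × Bool) (i : ℕ) :
    E.step^[i + 1] x = E.step (E.step^[i] x) := Function.iterate_succ_apply' ..

theorem dist_walkVert_le (x : G.Dart × Bool) (i j : ℕ) :
    G.dist (E.walkVert x i) (E.walkVert x (i + j)) ≤ j := by
  induction j with
  | zero => simp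
  | succ j ih =>
    have h1 := E.connected.dist_triangle (u := E.walkVert x i) (v := E.walkVert x (i + j))
      (w := E.walkVert x (i + (j + 1)))
    have h2 := (SimpleGraph.dist_eq_one_iff_adj).mpr (walkVert_adj (E := E) x (i + j))
    rw [Nat.add_assoc] at h2
    omega

theorem internal_of_dist_le (h7 : R.I7) {u v : V} (hv : v ∈ R.vertexRing) (huv : v ≠ u)
    (hd : G.dist v u ≤ 3) : R.Internal u := by
  rintro (⟨F, hF, hu⟩ | hu)
  · have := h7 (Sum.inr v) (Sum.inl F) hv hF (by simp) v rfl u hu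
    omega
  · have := h7 (Sum.inr v) (Sum.inr u) hv hu (by simpa using huv) v rfl u rfl
    omega

theorem initialCharge_of_meetsEdge {f : E.Face} (hf : R.InternalFace f) (h : E.MeetsEdge M f) :
    R.initialCharge M f = E.faceLength f - 4 + 5 / 3 := by
  simp [initialCharge, hf, h]

theorem initialCharge_of_not_meetsEdge {f : E.Face} (hf : R.InternalFace f)
    (h : ¬ E.MeetsEdge M f) : R.initialCharge M f = E.faceLength f - 4 := by
  simp [initialCharge, hf, h]

variable [Fintype V] [DecidableRel G.Adj]

/-- A vertex of degree two of a facial ring has both neighbors on this ring. -/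
theorem OnFacial.of_adj {v u : V} (hv : R.OnFacial v) (hd : G.degree v = 2) (h : G.Adj v u) :
    R.OnFacial u := by
  obtain ⟨F, hF, x, rfl, rfl⟩ := hv
  rcases E.eq_of_adj_of_degree_eq_two hd h with rfl | rfl
  · exact ⟨_, hF, E.alongEdge x, by simp, by simp⟩
  · exact ⟨_, hF, E.alongEdge (E.aroundCorner x), by simp, by simp⟩

/-- Both neighbors of a vertex of degree two of a facial ring keep their charge. -/
theorem not_receiving_of_adj (h5 : R.I5) {v u : V} (hv : R.OnFacial v) (hd : G.degree v = 2)
    (h : G.Adj v u) : ¬ R.Receiving u := by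
  rintro (⟨hu, -⟩ | hu)
  · exact h5 v u h ⟨hd, hu⟩
  · exact hu.1 (Or.inl (hv.of_adj hd h))

theorem not_receiving_of_mem_vertexRing {v : V} (hv : v ∈ R.vertexRing) : ¬ R.Receiving v := by
  rintro (⟨-, F, hF, hvF⟩ | h)
  · exact R.vertex_disjoint v hv F hF hvF
  · exact h.1 (Or.inr hv)

theorem SpendsAcross.walkVert (h3 : R.I3) {x : G.Dart × Bool} {i : ℕ}
    (h : R.SpendsAcross M (E.step^[i] x)) :
    R.InternalCubic (E.walkVert x i) ∧ R.InternalCubic (E.walkVert x (i + 1)) := by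
  refine ⟨h.fst_internalCubic h3, ?_⟩
  rw [← iterate_step_snd]
  exact h.snd_internalCubic h3

theorem SpendsAcross.walkVert_notMem_verts (h3 : R.I3) (hM : M.CapturesShortCycles)
    {x : G.Dart × Bool} {i : ℕ} (h : R.SpendsAcross M (E.step^[i] x)) :
    E.walkVert x i ∉ M.verts ∧ E.walkVert x (i + 1) ∉ M.verts := by
  refine ⟨h.fst_notMem_verts h3 hM, ?_⟩
  rw [← iterate_step_snd]
  exact h.alongEdge.fst_notMem_verts h3 hM

theorem SpendsAcross.next_notMem_vertexRing (h3 : R.I3) {x : G.Dart × Bool} {i : ℕ}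
    (h : R.SpendsAcross M (E.step^[i] x)) : E.walkVert x (i + 2) ∉ R.vertexRing := by
  have := h.alongEdge.back_notMem_vertexRing h3
  rwa [← walkVert_two, walkVert_iterate_step, Nat.add_comm] at this

theorem SpendsAcross.prev_notMem_vertexRing (h3 : R.I3) {x : G.Dart × Bool} {i : ℕ}
    (h : R.SpendsAcross M (E.step^[i + 1] x)) : E.walkVert x i ∉ R.vertexRing := by
  have := h.back_notMem_vertexRing h3
  rwa [iterate_step_add, aroundCorner_step, alongEdge_snd] at this

/-- The other vertices of a short face with a vertex ring are internal. -/
theorem internal_walkVert (h3 : R.I3) (h7 : R.I7) {x : G.Dart × Bool}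
    (hf : R.InternalFace (E.face x)) (hL : E.faceLength (E.face x) ≤ 7)
    (hv : E.walkVert x 0 ∈ R.vertexRing) {i : ℕ} (hi : i < E.faceLength (E.face x))
    (hi0 : 0 < i) : R.Internal (E.walkVert x i) := by
  refine internal_of_dist_le h7 hv (fun h => ?_) ?_
  · have := (h3 _ hf).1.walkVert_injOn (by omega) hi h
    omega
  · have h1 := dist_walkVert_le (E := E) x 0 i
    have h2 := dist_walkVert_le (E := E) x i (E.faceLength (E.face x) - i)
    rw [Nat.add_sub_cancel' hi.le] at h2
    have h4 := walkVert_add_faceLength (E := E) x 0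
    rw [Nat.zero_add] at h1 h4
    rw [h4, SimpleGraph.dist_comm] at h2
    omega

/-- A face incident with an edge of `M` sends no charge across this edge and the two neighboring
ones. -/
theorem le_primaryCharge_of_meetsEdge (h3 : R.I3) (hM : M.CapturesShortCycles) {f : E.Face}
    (hf : R.InternalFace f) (hL : E.faceLength f ≤ 6) (hm : E.MeetsEdge M f) :
    (E.faceLength f : ℝ) / 3 - 4 / 3 ≤ R.primaryCharge M f := by
  classical
  have hm' := hm
  obtain ⟨e, he, x, rfl, rfl⟩ := hm'
  have h := le_primaryCharge_of_spendsAcross (M := M) h3 hf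
  rw [initialCharge_of_meetsEdge hf hm] at h
  have hL5 := (h3 _ hf).2
  have m0 : E.walkVert x 0 ∈ M.verts := M.edge_vert he
  have m1 : E.walkVert x 1 ∈ M.verts := by
    rw [walkVert_one]; exact M.edge_vert (M.adj_symm he)
  have hwrap := walkVert_add_faceLength (E := E) x 0
  have p0 : ¬ R.SpendsAcross M (E.step^[0] x) := fun h => (h.walkVert_notMem_verts h3 hM).1 m0
  have p1 : ¬ R.SpendsAcross M (E.step^[1] x) := fun h => (h.walkVert_notMem_verts h3 hM).1 m1
  have h1 : (0 : ℝ) ≤ {v | R.Rule2Inc v (E.face x)}.ncard := Nat.cast_nonneg _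
  have h2 : (0 : ℝ) ≤ {v | R.IsCuffFaceOf (E.face x) v}.ncard := Nat.cast_nonneg _
  have ht : ∑ i ∈ Finset.range (E.faceLength (E.face x)),
      (if R.Receiving (E.walkVert x i) then 1 else 0) ≤ E.faceLength (E.face x) :=
    (Finset.sum_le_sum fun i _ => ite_le_one le_rfl zero_le_one).trans (by simp)
  have hp : (∑ i ∈ Finset.range (E.faceLength (E.face x)),
      if R.SpendsAcross M (E.step^[i] x) then 1 else 0) + 3 ≤ E.faceLength (E.face x) := by
    obtain hL' | hL' : E.faceLength (E.face x) = 5 ∨ E.faceLength (E.face x) = 6 := by omega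
    · have p4 : ¬ R.SpendsAcross M (E.step^[4] x) := fun h => by
        refine (h.walkVert_notMem_verts h3 hM).2 ?_
        rw [hL'] at hwrap
        exact hwrap ▸ m0
      simp only [hL', Finset.sum_range_succ, Finset.sum_range_zero, if_neg p0, if_neg p1,
        if_neg p4]
      split_ifs <;> omega
    · have p4 : ¬ R.SpendsAcross M (E.step^[5] x) := fun h => by
        refine (h.walkVert_notMem_verts h3 hM).2 ?_
        rw [hL'] at hwrap
        exact hwrap ▸ m0
      simp only [hL', Finset.sum_range_succ, Finset.sum_range_zero, if_neg p0, if_neg p1,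
        if_neg p4]
      split_ifs <;> omega
  have ht' := (Nat.cast_le (α := ℝ)).mpr ht
  have hp' := (Nat.cast_le (α := ℝ)).mpr hp
  push_cast at h ht' hp' ⊢
  linarith

/-- A cuff face gets `8/9` and sends no charge to the vertex ring and across the four edges closest
to it. -/
theorem le_primaryCharge_of_isCuffFace (h3 : R.I3) {f : E.Face}
    (hf : R.InternalFace f) (hL : E.faceLength f ≤ 6) (hm : ¬ E.MeetsEdge M f)
    (hc : R.IsCuffFace f) : (E.faceLength f : ℝ) / 3 - 13 / 9 ≤ R.primaryCharge M f := by
  classical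
  obtain ⟨v, hc⟩ := hc
  have hc' := hc
  obtain ⟨hv, hcv⟩ := hc'
  obtain ⟨x, hx, hxv⟩ := exists_walk_start (R.cuffFace_inc ⟨v, hv⟩)
  obtain rfl := hx.trans hcv
  have h := le_primaryCharge_of_spendsAcross (M := M) h3 hf
  rw [initialCharge_of_not_meetsEdge hf hm] at h
  have hL5 := (h3 _ hf).2
  have m0 : E.walkVert x 0 ∈ R.vertexRing := by rw [hxv]; exact hv
  have hwrap := walkVert_add_faceLength (E := E) x 0
  have c0 : ¬ R.Receiving (E.walkVert x 0) := not_receiving_of_mem_vertexRing m0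
  have p0 : ¬ R.SpendsAcross M (E.step^[0] x) := fun h =>
    (h.walkVert h3).1.1.not_mem_vertexRing m0
  have p1 : ¬ R.SpendsAcross M (E.step^[1] x) := fun h => h.prev_notMem_vertexRing h3 m0
  have h1 : (0 : ℝ) ≤ {v | R.Rule2Inc v (E.face x)}.ncard := Nat.cast_nonneg _
  have h2 : 1 ≤ {v | R.IsCuffFaceOf (E.face x) v}.ncard :=
    (Set.ncard_pos (Set.toFinite _)).mpr ⟨v, hc⟩
  have hpt : (∑ i ∈ Finset.range (E.faceLength (E.face x)),
      if R.Receiving (E.walkVert x i) then 1 else 0) + 1 ≤ E.faceLength (E.face x) ∧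
      (∑ i ∈ Finset.range (E.faceLength (E.face x)),
      if R.SpendsAcross M (E.step^[i] x) then 1 else 0) + 4 ≤ E.faceLength (E.face x) := by
    obtain hL' | hL' : E.faceLength (E.face x) = 5 ∨ E.faceLength (E.face x) = 6 := by omega
    · rw [hL'] at hwrap
      rw [← hwrap] at m0
      have p4 : ¬ R.SpendsAcross M (E.step^[4] x) := fun h =>
        (h.walkVert h3).2.1.not_mem_vertexRing m0
      have p3 : ¬ R.SpendsAcross M (E.step^[3] x) := fun h => h.next_notMem_vertexRing h3 m0
      simp only [hL', Finset.sum_range_succ, Finset.sum_range_zero, if_neg p0, if_neg p1,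
        if_neg p3, if_neg p4, if_neg c0]
      constructor <;> split_ifs <;> omega
    · rw [hL'] at hwrap
      rw [← hwrap] at m0
      have p4 : ¬ R.SpendsAcross M (E.step^[5] x) := fun h =>
        (h.walkVert h3).2.1.not_mem_vertexRing m0
      have p3 : ¬ R.SpendsAcross M (E.step^[4] x) := fun h => h.next_notMem_vertexRing h3 m0
      simp only [hL', Finset.sum_range_succ, Finset.sum_range_zero, if_neg p0, if_neg p1,
        if_neg p3, if_neg p4, if_neg c0]
      constructor <;> split_ifs <;> omega
  have ht' := (Nat.cast_le (α := ℝ)).mpr hpt.1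
  have hp' := (Nat.cast_le (α := ℝ)).mpr hpt.2
  have h2' := (Nat.cast_le (α := ℝ)).mpr h2
  push_cast at h ht' hp' h2' ⊢
  linarith

/-- In a 7-face without edges of `M`, some vertex keeps its charge. -/
theorem exists_not_receiving_of_seven (h5 : R.I5)
    (hconf : ∀ c : E.ConfigCopy, R.Appears c → c.Touches M) {x : G.Dart × Bool}
    (hB : E.BoundedByCycle (E.face x))
    (hf : R.InternalFace (E.face x)) (hL : E.faceLength (E.face x) = 7)
    (hm : ¬ E.MeetsEdge M (E.face x)) : ∃ v, E.VertexInc v (E.face x) ∧ ¬ R.Receiving v := by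
  by_contra! hall
  have hc : ∀ i, R.InternalCubic (E.walkVert x i) := by
    intro i
    refine (hall _ (vertexInc_walkVert x i)).resolve_left fun h => ?_
    exact not_receiving_of_adj h5 h.2 h.1 (walkVert_adj x i)
      (hall _ (vertexInc_walkVert x (i + 1)))
  have hnod := hB.nodup
  have htr := E.traces_walkVert x
  rw [hL] at hnod htr
  have happ := Appears.r2 (R := R) (E.face x) (E.walkVert x 0) (E.walkVert x 1) (E.walkVert x 2)
    (E.walkVert x 3) (E.walkVert x 4) (E.walkVert x 5) (E.walkVert x 6)
    ⟨⟨hnod, by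
      simp only [copyR2, List.mem_singleton]
      rintro p rfl
      refine ⟨hf, not_isCuffFace fun v hv => ?_, htr⟩
      obtain ⟨i, -, rfl⟩ := vertexInc_iff_walkVert.mp hv
      exact (hc i).1.not_mem_vertexRing, by
      simp [copyR2, hc], by simp [copyR2]⟩, by simp [copyR2]⟩
  obtain ⟨p, hp, hpM⟩ := hconf _ happ
  simp only [copyR2, List.mem_singleton] at hp
  rw [hp] at hpM
  exact hm hpM

/-- Some vertex of a 5-face without edges of `M` is not internal of degree three. -/
theorem exists_not_internalCubic_of_five
    (hconf : ∀ c : E.ConfigCopy, R.Appears c → c.Touches M) {x : G.Dart × Bool}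
    (hB : E.BoundedByCycle (E.face x))
    (hf : R.InternalFace (E.face x)) (hL : E.faceLength (E.face x) = 5)
    (hm : ¬ E.MeetsEdge M (E.face x)) : ∃ i < 5, ¬ R.InternalCubic (E.walkVert x i) := by
  by_contra! hc
  have hnod := hB.nodup
  have htr := E.traces_walkVert x
  rw [hL] at hnod htr
  have happ := Appears.r1 (R := R) (E.face x) (E.walkVert x 0) (E.walkVert x 1) (E.walkVert x 2)
    (E.walkVert x 3) (E.walkVert x 4)
    ⟨⟨hnod, by
      simp only [copyR1, List.mem_singleton]
      rintro p rfl
      refine ⟨hf, not_isCuffFace fun v hv => ?_, htr⟩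
      obtain ⟨i, hi, rfl⟩ := vertexInc_iff_walkVert.mp hv
      exact (hc i (by omega)).1.not_mem_vertexRing, by
      simp only [copyR1, List.mem_cons, List.not_mem_nil, or_false]
      rintro v (rfl | rfl | rfl | rfl | rfl) <;> exact hc _ (by omega),
      by simp [copyR1]⟩, by simp [copyR1]⟩
  obtain ⟨p, hp, hpM⟩ := hconf _ happ
  simp only [copyR1, List.mem_singleton] at hp
  rw [hp] at hpM
  exact hm hpM

/-- The configuration `R3` at every other vertex of a 6-face. -/
theorem false_of_r3 (hconf : ∀ c : E.ConfigCopy, R.Appears c → c.Touches M) {x : G.Dart × Bool}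
    (hB : E.BoundedByCycle (E.face x))
    (hf : R.InternalFace (E.face x)) (hL : E.faceLength (E.face x) = 6)
    (hm : ¬ E.MeetsEdge M (E.face x)) (hc : ¬ R.IsCuffFace (E.face x))
    (hv0 : E.walkVert x 0 ∉ R.vertexRing) (hv2 : R.Internal (E.walkVert x 2))
    (hv4 : R.Internal (E.walkVert x 4))
    (h : R.OnRing (E.walkVert x 0) ∨ ∃ i ∈ [0, 2, 4], R.Internal (E.walkVert x i) ∧
      ∀ w, G.Adj (E.walkVert x i) w → R.Internal w) : False := by
  have hnod := hB.nodup
  have htr := E.traces_walkVert x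
  rw [hL] at hnod htr
  have happ := Appears.r3 (R := R) (E.face x) (E.walkVert x 0) (E.walkVert x 1) (E.walkVert x 2)
    (E.walkVert x 3) (E.walkVert x 4) (E.walkVert x 5)
    ⟨⟨hnod, by
      simp only [copyR3, List.mem_singleton]
      rintro p rfl
      exact ⟨hf, hc, htr⟩, by
      simp [copyR3], by
      simp only [copyR3, List.mem_cons, List.not_mem_nil, or_false]
      rintro u (rfl | rfl | rfl) v (rfl | rfl | rfl) huv <;> first
        | exact absurd rfl huv
        | exact Or.inl hv2
        | exact Or.inl hv4
        | exact Or.inr hv2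
        | exact Or.inr hv4⟩, by
      simp only [copyR3, List.mem_cons, List.not_mem_nil, or_false]
      rintro u (rfl | rfl | rfl)
      · exact hv0
      · exact hv2.not_mem_vertexRing
      · exact hv4.not_mem_vertexRing⟩ (by
      rcases h with h | ⟨i, hi, h⟩
      · exact Or.inl ⟨_, by simp, h⟩
      · refine Or.inr ⟨E.walkVert x i, ?_, h⟩
        simp only [List.mem_cons, List.not_mem_nil, or_false] at hi
        rcases hi with rfl | rfl | rfl <;> simp)
  obtain ⟨p, hp, hpM⟩ := hconf _ happ
  simp only [copyR3, List.mem_singleton] at hp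
  rw [hp] at hpM
  exact hm hpM

/-- If an internal face contains two vertices of a ring at distance two along its boundary, then the
vertex between them belongs to the ring and has degree two, since the ring and the face fill both
corners at this vertex. -/
theorem middle_degree_eq_two (h3 : R.I3) (h4 : R.I4) {x : G.Dart × Bool}
    (hf : R.InternalFace (E.face x)) (hv0 : R.OnRing (E.walkVert x 0))
    (hv2 : R.OnRing (E.walkVert x 2)) : R.OnRing (E.walkVert x 1) ∧
      G.degree (E.walkVert x 1) = 2 := by
  obtain ⟨hB, hL⟩ := h3 _ hf
  have h02 : E.walkVert x 0 ≠ E.walkVert x 2 := fun h => by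
    have := hB.walkVert_injOn (by omega) (by omega) h
    omega
  have a0 := walkVert_adj (E := E) x 0
  have a1 := walkVert_adj (E := E) x 1
  let p : G.Walk (E.walkVert x 0) (E.walkVert x 2) := .cons a0 (.cons a1 .nil)
  have hp : p.IsPath := by
    simp only [p, SimpleGraph.Walk.cons_isPath_iff, SimpleGraph.Walk.IsPath.nil]
    simp [a0.ne, a1.ne, h02]
  have hsub := h4 _ _ p hp (by simp [p]) hv0 hv2
  have s0 : R.subgraph.Adj (E.walkVert x 0) (E.walkVert x 1) := hsub.2 (by simp [p])
  have s1 : R.subgraph.Adj (E.walkVert x 1) (E.walkVert x 2) := hsub.2 (by simp [p])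
  obtain ⟨-, F, hF, hF0⟩ := s0
  obtain ⟨-, F', hF', hF1⟩ := s1
  have hFF : F' = F := by
    by_contra hne
    exact R.facial_disjoint F' hF' F hF hne _ hF1.vertexInc
      (EdgeInc.vertexInc (v := E.walkVert x 0) (by rwa [Sym2.eq_swap]))
  rw [hFF] at hF1
  refine ⟨Or.inl ⟨F, hF, hF1.vertexInc⟩, ?_⟩
  -- an edge of the face `E.face x` that is incident with `F` has `F` on its other side
  have key : ∀ y, E.face y = E.face x → E.EdgeInc y.1.edge F →
      E.face (E.acrossEdge y) = F := by
    rintro y hy ⟨z, hz, hze⟩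
    have hne : E.face x ≠ F := fun h => hf (h ▸ hF)
    rcases E.eq_or_eq_of_edge_eq hze with (rfl | rfl) | (rfl | rfl)
    · exact absurd (hy.symm.trans hz) hne
    · rw [face_alongEdge] at hz
      exact absurd (hy.symm.trans hz) hne
    · exact hz
    · rwa [face_alongEdge] at hz
  have k0 := key (E.alongEdge x) (by simp) (by
    rw [alongEdge_edge]
    have := iterate_step_edge (E := E) x 0
    rw [← this] at hF0
    exact hF0)
  have k1 := key (E.step x) (by simp) (by
    have := iterate_step_edge (E := E) x 1
    rw [← this] at hF1
    exact hF1)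
  have hge : 2 ≤ G.degree (E.walkVert x 1) := by
    rw [← SimpleGraph.card_neighborFinset_eq_degree]
    have : ({E.walkVert x 0, E.walkVert x 2} : Set V).ncard = 2 := Set.ncard_pair h02
    rw [← this, ← Set.ncard_coe_finset]
    refine Set.ncard_le_ncard ?_ (Finset.finite_toSet _)
    rintro w (rfl | rfl)
    · simpa using a0.symm
    · simpa using a1
  -- `F` has a single corner at the vertex, so the two edges follow each other in both rotations
  have hle : ¬ 3 ≤ G.degree (E.walkVert x 1) := by
    intro hd
    rw [walkVert_one] at hd
    have hne := E.aroundCorner_acrossEdge_dart_ne (x := E.alongEdge x) hd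
    rcases (R.facial_cycle F hF).2 (E.acrossEdge (E.alongEdge x)) (E.acrossEdge (E.step x)) k0 k1
      (by simp) with h | h
    · have h' := congrArg E.acrossEdge h
      rw [acrossEdge_acrossEdge, acrossEdge_acrossEdge] at h'
      exact E.aroundCorner_ne _ h'
    · exact hne (congrArg Prod.fst h).symm
  omega

/-- A 6-face without edges of `M` and without vertex rings is not incident with ring vertices. -/
theorem internal_of_six (h3 : R.I3) (h4 : R.I4) (h5 : R.I5)
    (hconf : ∀ c : E.ConfigCopy, R.Appears c → c.Touches M) {f : E.Face}
    (hf : R.InternalFace f) (hL : E.faceLength f = 6) (hm : ¬ E.MeetsEdge M f)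
    (hv : ∀ v, E.VertexInc v f → v ∉ R.vertexRing) {v : V} (hvf : E.VertexInc v f) :
    R.Internal v := by
  intro hvR
  have two : ∀ x, E.face x = f → R.OnRing (E.walkVert x 0) →
      R.OnRing (E.walkVert x 2) ∨ R.OnRing (E.walkVert x 4) := by
    rintro x rfl h0
    by_contra! h
    exact false_of_r3 hconf (h3 _ hf).1 hf hL hm (not_isCuffFace hv)
      (hv _ (vertexInc_walkVert x 0)) h.1 h.2 (Or.inl h0)
  have mid : ∀ x, E.face x = f → R.OnRing (E.walkVert x 0) → R.OnRing (E.walkVert x 2) →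
      R.OnRing (E.walkVert x 1) ∧ G.degree (E.walkVert x 1) = 2 := by
    rintro x rfl
    exact middle_degree_eq_two h3 h4 hf
  have wrap : ∀ x, E.face x = f → ∀ i, E.walkVert x (i + 6) = E.walkVert x i := by
    rintro x rfl i
    rw [← hL, walkVert_add_faceLength]
  obtain ⟨y, hy, hyR⟩ : ∃ y, E.face y = f ∧
      R.OnRing (E.walkVert y 0) ∧ R.OnRing (E.walkVert y 2) := by
    obtain ⟨x, hx, rfl⟩ := exists_walk_start hvf
    rcases two x hx hvR with h | h
    · exact ⟨x, hx, hvR, h⟩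
    · refine ⟨E.step^[4] x, by simpa using hx, ?_, ?_⟩
      · rwa [walkVert_iterate_step]
      · rw [walkVert_iterate_step]
        exact (wrap x hx 0).symm ▸ hvR
  obtain ⟨h1, d1⟩ := mid y hy hyR.1 hyR.2
  rcases two (E.step y) (by simpa using hy) (by rwa [walkVert_step]) with h | h
  · rw [walkVert_step] at h
    have := mid (E.step y) (by simpa using hy) (by rwa [walkVert_step]) (by rwa [walkVert_step])
    rw [walkVert_step] at this
    exact h5 _ _ (walkVert_adj y 1) ⟨d1, this.2⟩
  · rw [walkVert_step] at h
    have := mid (E.step^[5] y) (by simpa using hy) (by rwa [walkVert_iterate_step]) (by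
      rw [walkVert_iterate_step]
      exact (wrap y hy 1).symm ▸ h1)
    rw [walkVert_iterate_step, Nat.add_comm, wrap y hy 0] at this
    exact h5 _ _ (walkVert_adj y 0) ⟨this.2, d1⟩

end Faces

end Rings

end EmbeddingScheme

/-! ### The charge of a face -/

namespace EmbeddingScheme

namespace Rings

section Conclusion

variable {V : Type*} {G : SimpleGraph V} {E : EmbeddingScheme G} {R : E.Rings}
  [Fintype V] [DecidableRel G.Adj] {M : G.Subgraph}

/-- A 6-face incident with a vertex ring, other than its cuff face, gets `1/3` from it. Its other
vertices are internal, and the configuration `R3` at the three vertices at odd distance from the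
vertex ring excludes sending charge across edges. -/
theorem le_primaryCharge_of_six_of_vertexRing (h3 : R.I3) (h7 : R.I7)
    (hconf : ∀ c : E.ConfigCopy, R.Appears c → c.Touches M) {f : E.Face}
    (hf : R.InternalFace f) (hL : E.faceLength f = 6) (hm : ¬ E.MeetsEdge M f)
    (hc : ¬ R.IsCuffFace f) {v : V} (hv : v ∈ R.vertexRing) (hvf : E.VertexInc v f) :
    2 / 3 ≤ R.primaryCharge M f := by
  classical
  obtain ⟨x, rfl, rfl⟩ := exists_walk_start hvf
  have hB := (h3 _ hf).1
  have hI : ∀ i < 6, 0 < i → R.Internal (E.walkVert x i) := fun i hi hi0 =>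
    internal_walkVert h3 h7 hf (by omega) hv (by omega) hi0
  have h := le_primaryCharge_of_spendsAcross (M := M) h3 hf
  rw [initialCharge_of_not_meetsEdge hf hm] at h
  have hwrap := walkVert_add_faceLength (E := E) x 0
  rw [hL] at hwrap
  have hv6 := hv
  rw [← hwrap] at hv6
  have c0 : ¬ R.Receiving (E.walkVert x 0) := not_receiving_of_mem_vertexRing hv
  have p0 : ¬ R.SpendsAcross M (E.step^[0] x) := fun h =>
    (h.walkVert h3).1.1.not_mem_vertexRing hv
  have p1 : ¬ R.SpendsAcross M (E.step^[1] x) := fun h => h.prev_notMem_vertexRing h3 hv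
  have p4 : ¬ R.SpendsAcross M (E.step^[4] x) := fun h => h.next_notMem_vertexRing h3 hv6
  have p5 : ¬ R.SpendsAcross M (E.step^[5] x) := fun h =>
    (h.walkVert h3).2.1.not_mem_vertexRing hv6
  have r3 : ¬ ∀ w, G.Adj (E.walkVert x 3) w → R.Internal w := fun hw => by
    refine false_of_r3 (x := E.step x) hconf (by simpa using hB) (by simpa using hf)
      (by simpa using hL) (by simpa using hm) (by simpa using hc) ?_ ?_ ?_
      (Or.inr ⟨2, by simp, ?_⟩)
    · rw [walkVert_step]; exact (hI 1 (by omega) (by omega)).not_mem_vertexRing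
    · rw [walkVert_step]; exact hI 3 (by omega) (by omega)
    · rw [walkVert_step]; exact hI 5 (by omega) (by omega)
    · rw [walkVert_step]; exact ⟨hI 3 (by omega) (by omega), hw⟩
  have p2 : ¬ R.SpendsAcross M (E.step^[2] x) := fun h => r3 fun w hw => by
    refine h.alongEdge.internal_of_adj h3 ?_ ?_ (w := w)
    · rw [← walkVert_two, walkVert_iterate_step]
      exact hI 4 (by omega) (by omega)
    · rwa [alongEdge_fst, iterate_step_snd]
  have p3 : ¬ R.SpendsAcross M (E.step^[3] x) := fun h => r3 fun w hw => by
    refine h.internal_of_adj h3 ?_ hw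
    rw [iterate_step_add, aroundCorner_step, alongEdge_snd]
    exact hI 2 (by omega) (by omega)
  have h1 : 1 ≤ {v | R.Rule2Inc v (E.face x)}.ncard :=
    (Set.ncard_pos (Set.toFinite _)).mpr ⟨_, hv, hvf, hc⟩
  have h2 : (0 : ℝ) ≤ {v | R.IsCuffFaceOf (E.face x) v}.ncard := Nat.cast_nonneg _
  have ht : ∑ i ∈ Finset.range (E.faceLength (E.face x)),
      (if R.Receiving (E.walkVert x i) then 1 else 0) ≤ 5 := by
    simp only [hL, Finset.sum_range_succ, Finset.sum_range_zero, if_neg c0]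
    split_ifs <;> omega
  have hp : ∑ i ∈ Finset.range (E.faceLength (E.face x)),
      (if R.SpendsAcross M (E.step^[i] x) then 1 else 0) = 0 := by
    simp only [hL, Finset.sum_range_succ, Finset.sum_range_zero, if_neg p0, if_neg p1, if_neg p2,
      if_neg p3, if_neg p4, if_neg p5]
  rw [hp, hL] at h
  rw [hL] at ht
  have ht' := (Nat.cast_le (α := ℝ)).mpr ht
  have h1' := (Nat.cast_le (α := ℝ)).mpr h1
  push_cast at h ht' h1' ⊢
  linarith

theorem exists_not_internalCubic_of_six (h1 : R.I1) {x : G.Dart × Bool}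
    (hB : E.BoundedByCycle (E.face x)) (hL : E.faceLength (E.face x) = 6) :
    ∃ i < 6, ¬ R.InternalCubic (E.walkVert x i) := by
  by_contra! hc
  have hnod := hB.nodup
  rw [hL] at hnod
  have a := walkVert_adj (E := E) x
  have a5 := a 5
  have hwrap := walkVert_add_faceLength (E := E) x 0
  rw [hL] at hwrap
  rw [show E.walkVert x (5 + 1) = E.walkVert x 0 from hwrap] at a5
  let c : G.Walk (E.walkVert x 0) (E.walkVert x 0) :=
    .cons (a 0) (.cons (a 1) (.cons (a 2) (.cons (a 3) (.cons (a 4) (.cons a5 .nil)))))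
  have hcyc : c.IsCycle := by
    rw [SimpleGraph.Walk.cons_isCycle_iff]
    simp only [show List.range 6 = [0, 1, 2, 3, 4, 5] from rfl, List.map_cons, List.map_nil,
      List.nodup_cons, List.mem_cons, List.not_mem_nil, or_false, not_or, not_false_eq_true,
      and_true, List.nodup_nil] at hnod
    simp only [SimpleGraph.Walk.cons_isPath_iff, SimpleGraph.Walk.IsPath.nil,
      SimpleGraph.Walk.support_cons, SimpleGraph.Walk.support_nil, SimpleGraph.Walk.edges_cons,
      SimpleGraph.Walk.edges_nil, List.mem_cons, List.not_mem_nil, or_false, Sym2.eq_iff]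
    clear * - hnod
    grind
  refine h1 _ c hcyc (by simp [c]; decide) ?_
  intro u hu
  simp only [c, SimpleGraph.Walk.support_cons, SimpleGraph.Walk.support_nil, List.mem_cons,
    List.not_mem_nil, or_false] at hu
  rcases hu with rfl | rfl | rfl | rfl | rfl | rfl | rfl <;> exact hc _ (by omega)

/-- A 6-face without edges of `M` and without ring vertices sends no charge across its edges because
of the configuration `R3`, and its vertices are not all internal of degree three. -/
theorem le_primaryCharge_of_six (h1 : R.I1) (h3 : R.I3)
    (hconf : ∀ c : E.ConfigCopy, R.Appears c → c.Touches M) {f : E.Face}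
    (hf : R.InternalFace f) (hL : E.faceLength f = 6) (hm : ¬ E.MeetsEdge M f)
    (hv : ∀ v, E.VertexInc v f → R.Internal v) : 1 / 3 ≤ R.primaryCharge M f := by
  classical
  obtain ⟨x, rfl⟩ := E.exists_face_eq f
  have hB := (h3 _ hf).1
  have h := le_primaryCharge_of_spendsAcross (M := M) h3 hf
  rw [initialCharge_of_not_meetsEdge hf hm] at h
  have hp0 : ∀ y, E.face y = E.face x → ¬ R.SpendsAcross M y := by
    intro y hy hP
    have hvy : ∀ i, R.Internal (E.walkVert y i) := fun i => hv _ (hy ▸ vertexInc_walkVert y i)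
    rw [← hy] at hB hf hL hm
    refine false_of_r3 (x := y) hconf hB hf hL hm ?_ (hvy 0).not_mem_vertexRing (hvy 2) (hvy 4)
      (Or.inr ⟨0, by simp, hvy 0, fun w hw => hP.internal_of_adj h3 ?_ hw⟩)
    · rw [hy]
      exact not_isCuffFace fun v hvf => (hv v hvf).not_mem_vertexRing
    · exact hv _ ⟨E.alongEdge (E.aroundCorner y), by simpa using hy, by simp⟩
  have hp : ∑ i ∈ Finset.range (E.faceLength (E.face x)),
      (if R.SpendsAcross M (E.step^[i] x) then 1 else 0) = 0 :=
    Finset.sum_eq_zero fun i _ => if_neg (hp0 _ (by simp))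
  obtain ⟨j, hj, hjc⟩ := exists_not_internalCubic_of_six h1 hB hL
  have hjr : ¬ R.Receiving (E.walkVert x j) := by
    rintro (⟨-, hF⟩ | hcub)
    · exact hv _ (vertexInc_walkVert x j) (Or.inl hF)
    · exact hjc hcub
  have ht : ∑ i ∈ Finset.range (E.faceLength (E.face x)),
      (if R.Receiving (E.walkVert x i) then 1 else 0) ≤ 5 := by
    simp only [hL, Finset.sum_range_succ, Finset.sum_range_zero]
    interval_cases j <;> simp only [if_neg hjr] <;> split_ifs <;> omega
  have h1 : (0 : ℝ) ≤ {v | R.Rule2Inc v (E.face x)}.ncard := Nat.cast_nonneg _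
  have h2 : (0 : ℝ) ≤ {v | R.IsCuffFaceOf (E.face x) v}.ncard := Nat.cast_nonneg _
  rw [hp, hL] at h
  rw [hL] at ht
  have ht' := (Nat.cast_le (α := ℝ)).mpr ht
  push_cast at h ht' ⊢
  linarith

theorem le_primaryCharge_of_seven (h3 : R.I3) (h5 : R.I5) (hM : M.CapturesShortCycles)
    (hconf : ∀ c : E.ConfigCopy, R.Appears c → c.Touches M) {f : E.Face}
    (hf : R.InternalFace f) (hL : 7 ≤ E.faceLength f) :
    2 / 9 ≤ R.primaryCharge M f ∧
      (8 ≤ E.faceLength f → 5 * (E.faceLength f : ℝ) / 9 - 4 ≤ R.primaryCharge M f) := by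
  classical
  obtain ⟨x, rfl⟩ := E.exists_face_eq f
  have hB := (h3 _ hf).1
  have h := le_primaryCharge_of_seven_le h3 hM hconf hf hL
  have ht : ∑ i ∈ Finset.range (E.faceLength (E.face x)),
      (if R.Receiving (E.walkVert x i) then 1 else 0) ≤ E.faceLength (E.face x) :=
    (Finset.sum_le_sum fun i _ => ite_le_one le_rfl zero_le_one).trans (by simp)
  have ht' := (Nat.cast_le (α := ℝ)).mpr ht
  have hL' := (Nat.cast_le (α := ℝ)).mpr hL
  by_cases hm : E.MeetsEdge M (E.face x)
  · rw [initialCharge_of_meetsEdge hf hm] at h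
    push_cast at h ht' hL' ⊢
    constructor
    · linarith
    · intro _; linarith
  · rw [initialCharge_of_not_meetsEdge hf hm] at h
    refine ⟨?_, fun _ => by push_cast at h ht' hL' ⊢; linarith⟩
    rcases hL.eq_or_lt with hL7 | hL8
    · obtain ⟨v, hv, hvr⟩ := exists_not_receiving_of_seven h5 hconf hB hf hL7.symm hm
      obtain ⟨j, hj, rfl⟩ := vertexInc_iff_walkVert.mp hv
      have ht6 : ∑ i ∈ Finset.range (E.faceLength (E.face x)),
          (if R.Receiving (E.walkVert x i) then 1 else 0) ≤ 6 := by
        rw [← hL7] at hj ⊢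
        simp only [Finset.sum_range_succ, Finset.sum_range_zero]
        interval_cases j <;> simp only [if_neg hvr] <;> split_ifs <;> omega
      have ht6' := (Nat.cast_le (α := ℝ)).mpr ht6
      have hL7' : (E.faceLength (E.face x) : ℝ) = 7 := by rw [← hL7]; norm_num
      rw [hL7'] at h
      push_cast at h ht6' ⊢
      linarith
    · have hL8' := (Nat.cast_le (α := ℝ)).mpr (Nat.succ_le_of_lt hL8)
      push_cast at h ht' hL8' ⊢
      linarith

variable (R M) in
/-- The alternatives for a 5-face of charge zero. -/
def ZeroReason (f : E.Face) : Prop :=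
  R.Dangerous M 3 f ∨
    (∃ v, E.VertexInc v f ∧ R.OnRing v) ∨
    (R.Dangerous M 4 f ∧ ∃ h e, R.LinkedThrough M h f e ∧ 6 ≤ E.faceLength h) ∨
    (R.Dangerous M 4 f ∧ ∃ h e, R.LinkedThrough M h f e ∧ E.faceLength h = 5 ∧
      (E.MeetsEdge M h ∨ R.IsCuffFace h)) ∨
    (R.Dangerous M 4 f ∧ ∃ v ∈ R.vertexRing, E.Opposite f v)

/-- A 4-dangerous face gets `1/3` from a ring vertex, from an opposite vertex ring, or from the
linked face. -/
theorem Dangerous.receives (h0 : R.I0) (h3 : R.I3) (hM : M.CapturesShortCycles)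
    (hconf : ∀ c : E.ConfigCopy, R.Appears c → c.Touches M) {f : E.Face}
    (hf : R.InternalFace f) (hc : ¬ R.IsCuffFace f) (hD : R.Dangerous M 4 f) :
    R.ZeroReason M f ∧ 1 ≤ {v | R.Rule2Facial M v f}.ncard + {v | R.Rule2Inc v f}.ncard +
      {v | R.Rule2Opp v f}.ncard + {p : E.Face × Sym2 V | R.Rule3 M p.1 f p.2}.ncard := by
  by_cases hr : ∃ v, E.VertexInc v f ∧ R.OnRing v
  · refine ⟨Or.inr (Or.inl hr), ?_⟩
    obtain ⟨v, hvf, hv | hv⟩ := hr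
    · have : 1 ≤ {v | R.Rule2Facial M v f}.ncard :=
        (Set.ncard_pos (Set.toFinite _)).mpr ⟨v, hv, hD, hvf⟩
      omega
    · have : 1 ≤ {v | R.Rule2Inc v f}.ncard :=
        (Set.ncard_pos (Set.toFinite _)).mpr ⟨v, hv, hvf, hc⟩
      omega
  by_cases ho : ∃ v ∈ R.vertexRing, E.Opposite f v
  · refine ⟨Or.inr (Or.inr (Or.inr (Or.inr ⟨hD, ho⟩))), ?_⟩
    obtain ⟨v, hv, hvo⟩ := ho
    have : 1 ≤ {v | R.Rule2Opp v f}.ncard :=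
      (Set.ncard_pos (Set.toFinite _)).mpr ⟨v, hv, hvo⟩
    omega
  push Not at hr ho
  have hE : R.Extreme M f := ⟨hD, hr, ho⟩
  obtain ⟨z, rfl, hz⟩ : ∃ z, E.face z = f ∧ ¬ R.InternalCubic (E.walkVert z 3) := by
    obtain ⟨x, rfl⟩ := E.exists_face_eq f
    obtain ⟨j, -, hjc⟩ := exists_not_internalCubic_of_five hconf (h3 _ hf).1 hf hD.1 hD.2.1
    refine ⟨E.step^[j + 2] x, by simp, ?_⟩
    have := walkVert_add_faceLength (E := E) x j
    rw [hD.1] at this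
    rwa [walkVert_iterate_step, show 3 + (j + 2) = j + 5 by omega, this]
  have hl : R.LinkedThrough M (E.face (E.acrossEdge z)) (E.face z) z.1.edge :=
    ⟨hD, z, rfl, rfl, hz, rfl⟩
  have hcase := Extreme.linked_face h0 h3 hM hconf hE hz
  constructor
  · rcases hcase with h6 | ⟨h5, h⟩
    · exact Or.inr (Or.inr (Or.inl ⟨hD, _, _, hl, h6⟩))
    · exact Or.inr (Or.inr (Or.inr (Or.inl ⟨hD, _, _, hl, h5, h⟩)))
  · have : 1 ≤ {p : E.Face × Sym2 V | R.Rule3 M p.1 (E.face z) p.2}.ncard :=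
      (Set.ncard_pos (Set.toFinite _)).mpr
        ⟨(E.face (E.acrossEdge z), z.1.edge), hE, hl, hcase.imp id (·.2)⟩
    omega

/-- A 5-face that is not a cuff face and has no edges of `M` sends charge to vertices only, and its
charge is a multiple of `1/3`. -/
theorem primaryCharge_of_five (h0 : R.I0) (h3 : R.I3) (h5 : R.I5) (hM : M.CapturesShortCycles)
    (hconf : ∀ c : E.ConfigCopy, R.Appears c → c.Touches M) {f : E.Face}
    (hf : R.InternalFace f) (hL : E.faceLength f = 5) (hm : ¬ E.MeetsEdge M f)
    (hc : ¬ R.IsCuffFace f) :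
    (R.primaryCharge M f = 0 ∧ R.ZeroReason M f) ∨ 1 / 3 ≤ R.primaryCharge M f := by
  classical
  obtain ⟨x, rfl⟩ := E.exists_face_eq f
  have hB := (h3 _ hf).1
  have hcuff : {v | R.IsCuffFaceOf (E.face x) v} = ∅ :=
    Set.eq_empty_of_forall_notMem fun v hv => hc ⟨v, hv⟩
  have hr3 : {p : E.Face × Sym2 V | R.Rule3 M (E.face x) p.1 p.2} = ∅ := by
    refine Set.eq_empty_of_forall_notMem ?_
    rintro p ⟨-, -, h | h | h⟩
    · omega
    · exact hm h
    · exact hc h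
  have hr4 : {p : E.Face × Sym2 V | R.Rule4 M (E.face x) p.1 p.2} = ∅ := by
    refine Set.eq_empty_of_forall_notMem ?_
    rintro p ⟨-, -, h, -⟩
    omega
  have hr4' : {p : E.Face × Sym2 V | R.Rule4 M p.1 (E.face x) p.2} = ∅ := by
    refine Set.eq_empty_of_forall_notMem ?_
    rintro p ⟨-, h, -⟩
    omega
  have hcharge : R.primaryCharge M (E.face x) = R.primaryCharge M (E.face x) := rfl
  conv_rhs at hcharge => rw [primaryCharge]
  rw [initialCharge_of_not_meetsEdge hf hm, hcuff, hr3, hr4, hr4', Set.ncard_empty,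
    Set.ncard_empty, hL] at hcharge
  set t := {v | R.Rule1 (E.face x) v}.ncard with ht
  set a := {v | R.Rule2Facial M v (E.face x)}.ncard
  set b := {v | R.Rule2Inc v (E.face x)}.ncard
  set c := {v | R.Rule2Opp v (E.face x)}.ncard
  set d := {p : E.Face × Sym2 V | R.Rule3 M p.1 (E.face x) p.2}.ncard
  have key : (t = 3 ∧ R.ZeroReason M (E.face x)) ∨ t ≤ 2 ∨
      (t = 4 ∧ R.ZeroReason M (E.face x) ∧ 1 ≤ a + b + c + d) := by
    by_cases h2 : ∃ v, E.VertexInc v (E.face x) ∧ G.degree v = 2 ∧ R.OnFacial v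
    · obtain ⟨v, hvf, hd, hv⟩ := h2
      have hz : R.ZeroReason M (E.face x) := Or.inr (Or.inl ⟨v, hvf, Or.inl hv⟩)
      have ht3 : t ≤ 3 := by
        obtain ⟨y, hy, rfl⟩ := exists_walk_start hvf
        rw [← hy] at hf hL
        have ht' := ncard_rule1 h3 hf
        rw [hy, ← ht, ← hy, hL] at ht'
        have c1 : ¬ R.Receiving (E.walkVert y 1) :=
          not_receiving_of_adj h5 hv hd (walkVert_adj y 0)
        have c4 : ¬ R.Receiving (E.walkVert y 4) := by
          refine not_receiving_of_adj h5 hv hd ?_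
          have : G.Adj (E.walkVert y 4) (E.walkVert y 5) := walkVert_adj y 4
          rw [walkVert_five hL] at this
          exact this.symm
        rw [ht']
        simp only [Finset.sum_range_succ, Finset.sum_range_zero, if_neg c1, if_neg c4]
        split_ifs <;> omega
      rcases ht3.eq_or_lt with h | h
      · exact Or.inl ⟨h, hz⟩
      · exact Or.inr (Or.inl (by omega))
    · push Not at h2
      have hset : {v | R.Rule1 (E.face x) v} =
          {v | E.VertexInc v (E.face x) ∧ R.InternalCubic v} := by
        ext v
        constructor
        · rintro ⟨-, hv, h | h⟩
          · exact absurd h.2 (h2 v hv h.1)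
          · exact ⟨hv, h⟩
        · rintro ⟨hv, h⟩
          exact ⟨hf, hv, Or.inr h⟩
      rw [hset] at ht
      have ht4 : t ≤ 4 := by
        obtain ⟨j, hj, hjc⟩ := exists_not_internalCubic_of_five hconf hB hf hL hm
        rw [ht, ncard_vertexInc_and hB, hL]
        simp only [Finset.sum_range_succ, Finset.sum_range_zero]
        interval_cases j <;> simp only [if_neg hjc] <;> split_ifs <;> omega
      have hD : R.Dangerous M t (E.face x) := ⟨hL, hm, ht.symm⟩
      obtain h | h | h : t = 4 ∨ t = 3 ∨ t ≤ 2 := by omega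
      · rw [h] at hD
        exact Or.inr (Or.inr ⟨h, Dangerous.receives h0 h3 hM hconf hf hc hD⟩)
      · rw [h] at hD
        exact Or.inl ⟨h, Or.inl hD⟩
      · exact Or.inr (Or.inl h)
  have hcharge' : R.primaryCharge M (E.face x) = (3 - t + (a + b + c + d : ℕ)) / 3 := by
    rw [hcharge]; push_cast; ring
  have hab : (0 : ℝ) ≤ (a + b + c + d : ℕ) := Nat.cast_nonneg _
  rw [hcharge']
  rcases key with ⟨h, hz⟩ | h | ⟨h, hz, h1⟩
  · rw [h]
    rcases Nat.eq_zero_or_pos (a + b + c + d) with h' | h'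
    · left; rw [h']; exact ⟨by norm_num, hz⟩
    · right
      have : (1 : ℝ) ≤ (a + b + c + d : ℕ) := by exact_mod_cast h'
      push_cast at this ⊢; linarith
  · right
    have : (t : ℝ) ≤ 2 := by exact_mod_cast h
    linarith
  · rw [h]
    rcases h1.eq_or_lt with h' | h'
    · left; rw [← h']; exact ⟨by norm_num, hz⟩
    · right
      have : (2 : ℝ) ≤ (a + b + c + d : ℕ) := by exact_mod_cast h'
      push_cast at this ⊢; linarith

end Conclusion

end Rings

end EmbeddingScheme

theorem mainTheorem5 {V : Type*} [Fintype V] {G : SimpleGraph V} [DecidableRel G.Adj]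
    (E : EmbeddingScheme G) (R : E.Rings) (M : G.Subgraph)
    (h0 : R.I0) (h1 : R.I1) (h3 : R.I3) (h4 : R.I4) (h5 : R.I5) (h7 : R.I7)
    (hM : M.CapturesShortCycles)
    (hconf : ∀ c : E.ConfigCopy, R.Appears c → c.Touches M)
    (f : E.Face) (hf : R.InternalFace f) :
    0 ≤ R.primaryCharge M f ∧
    (R.primaryCharge M f = 0 →
      E.faceLength f = 5 ∧ ¬ E.MeetsEdge M f ∧ ¬ R.IsCuffFace f ∧
      (R.Dangerous M 3 f ∨
        (∃ v, E.VertexInc v f ∧ R.OnRing v) ∨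
        (R.Dangerous M 4 f ∧ ∃ h e, R.LinkedThrough M h f e ∧ 6 ≤ E.faceLength h) ∨
        (R.Dangerous M 4 f ∧ ∃ h e, R.LinkedThrough M h f e ∧ E.faceLength h = 5 ∧
          (E.MeetsEdge M h ∨ R.IsCuffFace h)) ∨
        (R.Dangerous M 4 f ∧ ∃ v ∈ R.vertexRing, E.Opposite f v))) ∧
    (R.primaryCharge M f ≠ 0 → 2 / 9 ≤ R.primaryCharge M f) ∧
    (8 ≤ E.faceLength f → 5 * (E.faceLength f : ℝ) / 9 - 4 ≤ R.primaryCharge M f) ∧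
    (E.faceLength f = 6 → (∃ v, E.VertexInc v f ∧ G.degree v = 2 ∧ R.OnFacial v) →
      2 / 3 ≤ R.primaryCharge M f) := by
  have hL5 := (h3 _ hf).2
  have of_pos : ∀ {c : ℝ} {Z A B : Prop}, 2 / 9 ≤ c → A → B →
      0 ≤ c ∧ (c = 0 → Z) ∧ (c ≠ 0 → 2 / 9 ≤ c) ∧ A ∧ B := fun h hA hB =>
    ⟨by linarith, fun h' => absurd h' (by linarith), fun _ => h, hA, hB⟩
  by_cases hL7 : 7 ≤ E.faceLength f
  · obtain ⟨h, h8⟩ := EmbeddingScheme.Rings.le_primaryCharge_of_seven h3 h5 hM hconf hf hL7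
    exact of_pos h h8 fun h6 => by omega
  have h8 : 8 ≤ E.faceLength f → 5 * (E.faceLength f : ℝ) / 9 - 4 ≤ R.primaryCharge M f :=
    fun h => by omega
  by_cases hm : E.MeetsEdge M f
  · have h := EmbeddingScheme.Rings.le_primaryCharge_of_meetsEdge h3 hM hf (by omega) hm
    have hL5' := (Nat.cast_le (α := ℝ)).mpr hL5
    push_cast at hL5'
    refine of_pos (by linarith) h8 fun h6 _ => ?_
    rw [h6] at h
    push_cast at h
    linarith
  -- On a 6-face, a vertex of a facial ring would be too close to a vertex ring.
  have no_facial : E.faceLength f = 6 → ∀ v ∈ R.vertexRing, E.VertexInc v f →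
      ¬ ∃ v, E.VertexInc v f ∧ G.degree v = 2 ∧ R.OnFacial v := by
    rintro h6 v hv hvf ⟨u, huf, -, hu⟩
    obtain ⟨x, rfl, rfl⟩ := EmbeddingScheme.Rings.exists_walk_start hvf
    obtain ⟨i, hi, rfl⟩ := EmbeddingScheme.vertexInc_iff_walkVert.mp huf
    rcases Nat.eq_zero_or_pos i with rfl | hi0
    · obtain ⟨F, hF, hu⟩ := hu
      exact R.vertex_disjoint _ hv F hF hu
    · exact EmbeddingScheme.Rings.internal_walkVert h3 h7 hf (by omega) hv hi hi0 (Or.inl hu)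
  by_cases hc : R.IsCuffFace f
  · have h := EmbeddingScheme.Rings.le_primaryCharge_of_isCuffFace h3 hf (by omega) hm hc
    have hL5' := (Nat.cast_le (α := ℝ)).mpr hL5
    push_cast at hL5'
    refine of_pos (by linarith) h8 fun h6 hex => ?_
    obtain ⟨v, hv, rfl⟩ := hc
    exact absurd hex (no_facial h6 v hv (R.cuffFace_inc ⟨v, hv⟩))
  obtain h5' | h6 : E.faceLength f = 5 ∨ E.faceLength f = 6 := by omega
  · rcases EmbeddingScheme.Rings.primaryCharge_of_five h0 h3 h5 hM hconf hf h5' hm hc with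
      ⟨h, hz⟩ | h
    · exact ⟨h.ge, fun _ => ⟨h5', hm, hc, hz⟩, fun h' => absurd h h', h8,
        fun h6 => by omega⟩
    · exact of_pos (by linarith) h8 fun h6 => by omega
  · by_cases hv : ∃ v ∈ R.vertexRing, E.VertexInc v f
    · obtain ⟨v, hv, hvf⟩ := hv
      have h := EmbeddingScheme.Rings.le_primaryCharge_of_six_of_vertexRing h3 h7 hconf hf h6 hm
        hc hv hvf
      exact of_pos (by linarith) h8 fun _ _ => h
    · push Not at hv
      have hI : ∀ v, E.VertexInc v f → R.Internal v := fun v hvf =>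
        EmbeddingScheme.Rings.internal_of_six h3 h4 h5 hconf hf h6 hm
          (fun u hu hu' => hv u hu' hu) hvf
      have h := EmbeddingScheme.Rings.le_primaryCharge_of_six h1 h3 hconf hf h6 hm hI
      refine of_pos (by linarith) h8 fun _ ⟨v, hvf, _, hvF⟩ => ?_
      exact absurd (Or.inl hvF) (hI v hvf)
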